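/- Let $d>1$. Consider formal power series with real coefficients in $x=(x^1,\dots,x^d)$. The phylon group $\mathcal P(d)$ is the group, under composition, of all $\psi=(\psi^1,\dots,\psi^d)$ whose components are formal power series without constant term and whose linear part is an invertible matrix; the spherical phylon group $\mathcal S(d)$ is the subgroup of all $\psi\in\mathcal P(d)$ with $\|\psi(x)\|^2=\|x\|^2$, where $\|x\|^2=\sum_i (x^i)^2$. Let $\mathcal V(d)$ be the set of formal power series $b$ with $b(0)\neq 0$, on which $\mathcal P(d)$ acts by $$(\psi b)(x)=b(\psi^{-1}(x))\,\Bigl|\det\Bigl(\frac{\partial(\psi^{-1})^i}{\partial x^j}\Bigr)\Bigr| ,$$ where for a power series $a$ with $a(0)\ne0$ one puts $|a|=a$ if $a(0)>0$ and $|a|=-a$ if $a(0)<0$. For $i=0,1,2,\dots$ let $\Lambda_i(b)$ be the coefficient of $n^{-d/2}n^{-i/2}$ in the formal Laplace expansion of $\int_{\mathbb R^d}e^{-n\|x\|^2}b(x)\,dx^1\cdots dx^d$, that is, $\Lambda_i(b)=\int_{\mathbb R^d}e^{-\|x\|^2}b_{(i)}(x)\,dx^1\cdots dx^d$ with $b_{(i)}$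 the homogeneous part of degree $i$ of $b$. Let $b,c\in\mathcal V(d)$. Then there is $\psi\in\mathcal S(d)$ with $\psi b=c$ if and only if $\Lambda_i(b)=\Lambda_i(c)$ for all $i\ge 0$. Moreover, for all $i$, $$\Lambda_i(b)=\frac{\pi^{d/2}}{(i/2)!\,2^i}\,\mathrm{ctr}_i(b)\quad (i \text{ even}),\qquad \Lambda_i(b)=0\quad (i\text{ odd}),$$ where for $i=2j$ the $i$-th complete trace is $\mathrm{ctr}_i(b)=\sum_{k_1,\dots,k_j=1}^d b_{k_1k_1\dots k_jk_j}$ with $b_{i_1\dots i_r}=\frac{\partial^r b}{\partial x^{i_1}\cdots\partial x^{i_r}}(0)$. -/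

import Mathlib

namespace FormalLaplace

open MvPowerSeries Finset

/-- Formal power series in `d` real variables. -/
abbrev Series (d : ℕ) : Type := MvPowerSeries (Fin d) ℝ

/-- The matrix `(ψ^i_j)` of the linear part of `ψ = (ψ^1, …, ψ^d)`. -/
noncomputable def linearPart {d : ℕ} (ψ : Fin d → Series d) : Matrix (Fin d) (Fin d) ℝ :=
  Matrix.of fun i j => coeff (Finsupp.single j 1) (ψ i)

/-- The phylon group: formal power series in `d` variables with values in `ℝ^d`, without constant
term and with invertible linear part. -/
@[ext]
structure Phylon (d : ℕ) where
  toFun : Fin d → Series d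
  constantCoeff_eq_zero : ∀ i, constantCoeff (toFun i) = 0
  isUnit_linearPart : IsUnit (linearPart toFun).det

/-! ### Composition of formal power series and the group structure -/

section Auxiliary

variable {d : ℕ}

lemma hasSubst {a : Fin d → Series d} (ha : ∀ i, constantCoeff (a i) = 0) : HasSubst a :=
  hasSubst_of_constantCoeff_zero ha

lemma order_le_order_subst {a : Fin d → Series d} (ha : ∀ i, constantCoeff (a i) = 0)
    (f : Series d) : f.order ≤ (f.subst a).order := by
  refine le_trans ?_ (le_order_subst (hasSubst ha) f)
  have h : (1 : ℕ∞) ≤ ⨅ i, (a i).order :=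
    le_iInf fun i => (one_le_order_iff_constCoeff_eq_zero).2 (ha i)
  calc f.order = 1 * f.order := (one_mul _).symm
    _ ≤ _ := mul_le_mul' h le_rfl

lemma linear_coeff_subst {a : Fin d → Series d} (ha : ∀ i, constantCoeff (a i) = 0)
    (f : Series d) (j : Fin d) :
    coeff (Finsupp.single j 1) (f.subst a) =
      ∑ k, coeff (Finsupp.single k 1) f * coeff (Finsupp.single j 1) (a k) := by
  classical
  set r : Series d := f - C (constantCoeff f) - ∑ k, (coeff (Finsupp.single k 1) f) • X k with hr
  have hf : f = r + C (constantCoeff f) + ∑ k, (coeff (Finsupp.single k 1) f) • X k := by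
    rw [hr]; ring
  have hord : ((2 : ℕ) : ℕ∞) ≤ r.order := by
    refine nat_le_order fun m hm => ?_
    have hm' : m.degree = 0 ∨ m.degree = 1 := by omega
    rcases hm' with h | h
    · have h0 : m = 0 := (Finsupp.degree_eq_zero_iff m).1 h
      subst h0
      simp [hr]
    · obtain ⟨k, rfl⟩ : ∃ k, m = Finsupp.single k 1 := by
        have h' : m ∈ Set.range (fun k : Fin d => Finsupp.single k 1) := by
          rw [Finsupp.range_single_one]
          exact h
        obtain ⟨k, hk⟩ := h'
        exact ⟨k, hk.symm⟩
      simp only [hr, map_sub, map_sum, map_smul, coeff_C, coeff_X, smul_eq_mul]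
      simp [Finsupp.single_left_inj]
  have hz : coeff (Finsupp.single j 1) (r.subst a) = 0 := by
    refine coeff_of_lt_order (lt_of_lt_of_le ?_ (hord.trans (order_le_order_subst ha r)))
    simp
  have hs := hasSubst ha
  conv_lhs => rw [hf]
  rw [← substAlgHom_apply hs]
  simp only [map_add, map_sum, map_smul, substAlgHom_apply, hz, subst_X hs, subst_C, coeff_C,
    smul_eq_mul, zero_add]
  simp

lemma constantCoeff_subst_eq {a : Fin d → Series d} (ha : ∀ i, constantCoeff (a i) = 0)
    (f : Series d) : constantCoeff (f.subst a) = constantCoeff f := by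
  have h := constantCoeff_subst_eq_zero (hasSubst ha) ha
    (f := f - C (constantCoeff f)) (by simp)
  rw [subst_sub (hasSubst ha), subst_C, map_sub] at h
  simpa [sub_eq_zero] using h

lemma linearPart_subst {a : Fin d → Series d} (ha : ∀ i, constantCoeff (a i) = 0)
    (f : Fin d → Series d) :
    linearPart (fun i => (f i).subst a) = linearPart f * linearPart a := by
  ext i j
  simp [linearPart, Matrix.mul_apply, linear_coeff_subst ha]

lemma linearPart_X : linearPart (X : Fin d → Series d) = 1 := by
  classical
  ext i j
  simp [linearPart, coeff_X, Matrix.one_apply, Finsupp.single_left_inj, eq_comm]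

/-- A substitution tangent to the identity raises the order of `f ↦ f - f ∘ a`. -/
lemma order_sub_subst {a : Fin d → Series d} (ha : ∀ i, constantCoeff (a i) = 0)
    (ha' : ∀ i, ((2 : ℕ) : ℕ∞) ≤ (a i - X i).order) (f : Series d) (n : ℕ)
    (hf : (n : ℕ∞) ≤ f.order) : ((n + 1 : ℕ) : ℕ∞) ≤ (f - f.subst a).order := by
  classical
  have hpow : ∀ (i : Fin d) (k : ℕ), ((k + 1 : ℕ) : ℕ∞) ≤ (a i ^ k - X i ^ k).order := by
    intro i k
    induction k with
    | zero => simp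
    | succ k ih =>
      have e : a i ^ (k + 1) - X i ^ (k + 1)
          = (a i ^ k - X i ^ k) * a i + X i ^ k * (a i - X i) := by ring
      rw [e]
      refine le_trans (le_min ?_ ?_) min_order_le_add
      · refine le_trans ?_ le_order_mul
        push_cast
        have := (one_le_order_iff_constCoeff_eq_zero).2 (ha i)
        exact add_le_add (by exact_mod_cast ih) this
      · refine le_trans ?_ le_order_mul
        have h1 : (k : ℕ∞) ≤ ((X i : Series d) ^ k).order :=
          le_order_pow_of_constantCoeff_eq_zero k (by simp)
        calc ((k + 1 + 1 : ℕ) : ℕ∞) = (k : ℕ∞) + ((2 : ℕ) : ℕ∞) := by push_cast; ring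
          _ ≤ _ := add_le_add h1 (ha' i)
  have hmon : ∀ e : Fin d →₀ ℕ, ((e.degree + 1 : ℕ) : ℕ∞) ≤
      ((e.prod fun s k => a s ^ k) - (e.prod fun s k => (X s : Series d) ^ k)).order := by
    intro e
    induction e using Finsupp.induction with
    | zero => simp
    | single_add i k e hi hk ih =>
      rw [Finsupp.prod_add_index' (by simp) (by intros; rw [pow_add]),
        Finsupp.prod_add_index' (by simp) (by intros; rw [pow_add]),
        Finsupp.prod_single_index (by simp), Finsupp.prod_single_index (by simp)]
      set P := e.prod fun s k => a s ^ k
      set Q := e.prod fun s k => (X s : Series d) ^ k with hQ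
      have e1 : a i ^ k * P - X i ^ k * Q
          = a i ^ k * (P - Q) + (a i ^ k - X i ^ k) * Q := by ring
      rw [e1]
      have hQo : (e.degree : ℕ∞) ≤ Q.order := by
        refine le_trans ?_ (le_order_prod _ e.support)
        rw [Finsupp.degree_apply, Nat.cast_sum]
        exact Finset.sum_le_sum fun s _ => le_order_pow_of_constantCoeff_eq_zero _ (by simp)
      have hao : (k : ℕ∞) ≤ (a i ^ k).order := le_order_pow_of_constantCoeff_eq_zero k (ha i)
      refine le_trans (le_min ?_ ?_) min_order_le_add
      · refine le_trans ?_ le_order_mul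
        calc _ = (k : ℕ∞) + ((e.degree + 1 : ℕ) : ℕ∞) := by
              simp only [map_add, Finsupp.degree_single]; push_cast; ring
          _ ≤ _ := add_le_add hao ih
      · refine le_trans ?_ le_order_mul
        calc _ = ((k + 1 : ℕ) : ℕ∞) + (e.degree : ℕ∞) := by
              simp only [map_add, Finsupp.degree_single]; push_cast; ring
          _ ≤ _ := add_le_add (hpow i k) hQo
  refine nat_le_order fun m hm => ?_
  have hX : f.subst (X : Fin d → Series d) = f := by rw [subst_self]; rfl
  rw [map_sub, sub_eq_zero]
  conv_lhs => rw [← hX]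
  rw [coeff_subst HasSubst.X, coeff_subst (hasSubst ha)]
  refine finsum_congr fun e => ?_
  rcases lt_or_ge e.degree n with h | h
  · rw [coeff_of_lt_order (lt_of_lt_of_le (by exact_mod_cast h) hf), zero_smul, zero_smul]
  · congr 1
    have := coeff_of_lt_order (lt_of_lt_of_le
      (by exact_mod_cast (by omega : m.degree < e.degree + 1)) (hmon e))
    rw [map_sub, sub_eq_zero] at this
    exact this.symm

/-- Substitutions tangent to the identity are surjective on formal power series. -/
lemma exists_subst_eq {a : Fin d → Series d} (ha : ∀ i, constantCoeff (a i) = 0)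
    (ha' : ∀ i, ((2 : ℕ) : ℕ∞) ≤ (a i - X i).order) (b : Series d) :
    ∃ g : Series d, g.subst a = b := by
  have hs := hasSubst ha
  set T : Module.End ℝ (Series d) := 1 - (substAlgHom (R := ℝ) hs).toLinearMap with hT
  have hTf : ∀ f, T f = f - f.subst a := fun f => by simp [hT]
  have hTo : ∀ k : ℕ, (k : ℕ∞) ≤ ((T ^ k) b).order := by
    intro k
    induction k with
    | zero => simp
    | succ k ih =>
      rw [pow_succ', Module.End.mul_apply, hTf]
      exact order_sub_subst ha ha' _ k ih
  set S : ℕ → Series d := fun n => ∑ k ∈ range (n + 1), (T ^ k) b with hS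
  let g : Series d := fun m => coeff m (S m.degree)
  have hg : ∀ m, coeff m g = coeff m (S m.degree) := fun m => rfl
  refine ⟨g, ?_⟩
  have hstab : ∀ (m : Fin d →₀ ℕ) (n : ℕ), m.degree ≤ n →
      coeff m (S n) = coeff m (S m.degree) := by
    intro m n hmn
    induction n, hmn using Nat.le_induction with
    | base => rfl
    | succ n hn ih =>
      have : S (n + 1) = S n + (T ^ (n + 1)) b := by simp only [hS]; rw [sum_range_succ]
      rw [this, map_add, ih, coeff_of_lt_order (lt_of_lt_of_le ?_ (hTo (n + 1))), add_zero]
      exact_mod_cast (by omega : m.degree < n + 1)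
  ext m
  set n := m.degree with hn
  have hord : ((n + 1 : ℕ) : ℕ∞) ≤ (g - S n).order := by
    refine nat_le_order fun m' hm' => ?_
    rw [map_sub, hg, hstab m' n (by omega), sub_self]
  have h1 : coeff m ((g - S n).subst a) = 0 := by
    refine coeff_of_lt_order (lt_of_lt_of_le ?_ (hord.trans (order_le_order_subst ha _)))
    exact_mod_cast (by omega : m.degree < n + 1)
  have h2 : (S n).subst a = b - (T ^ (n + 1)) b := by
    have h3 : (1 - T) (S n) = (S n).subst a := by
      simp [hTf]
    have h4 := congrArg (fun L : Module.End ℝ (Series d) => L b) (mul_neg_geom_sum T (n + 1))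
    simp only [Module.End.mul_apply, LinearMap.sum_apply, LinearMap.sub_apply,
      Module.End.one_apply] at h4
    rw [← h3]
    simpa [hS] using h4
  rw [subst_sub hs, map_sub, h2, map_sub, sub_eq_zero] at h1
  rw [h1, coeff_of_lt_order (lt_of_lt_of_le ?_ (hTo (n + 1))), sub_zero]
  exact_mod_cast (by omega : m.degree < n + 1)

/-- Formal inverse function theorem. -/
lemma exists_left_inverse (ψ : Phylon d) :
    ∃ φ : Phylon d, ∀ i, (φ.toFun i).subst ψ.toFun = X i := by
  classical
  have hψ := hasSubst ψ.constantCoeff_eq_zero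
  set B : Matrix (Fin d) (Fin d) ℝ := (linearPart ψ.toFun)⁻¹ with hB
  have hBA : B * linearPart ψ.toFun = 1 := Matrix.nonsing_inv_mul _ ψ.isUnit_linearPart
  let L : Fin d → Series d := fun i => ∑ j, B i j • X j
  have hL : ∀ i, constantCoeff (L i) = 0 := fun i => by
    simp only [L, map_sum, ← coeff_zero_eq_constantCoeff_apply, map_smul]
    simp
  let a : Fin d → Series d := fun i => (L i).subst ψ.toFun
  have ha : ∀ i, constantCoeff (a i) = 0 := fun i => by
    rw [constantCoeff_subst_eq ψ.constantCoeff_eq_zero, hL]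
  have hlin : linearPart a = 1 := by
    rw [show a = fun i => (L i).subst ψ.toFun from rfl,
      linearPart_subst ψ.constantCoeff_eq_zero]
    convert hBA using 2
    ext i j
    simp only [linearPart, Matrix.of_apply, L, map_sum, map_smul, coeff_X, smul_eq_mul]
    simp [Finsupp.single_left_inj]
  have ha' : ∀ i, ((2 : ℕ) : ℕ∞) ≤ (a i - X i).order := by
    intro i
    refine nat_le_order fun m hm => ?_
    have hm' : m.degree = 0 ∨ m.degree = 1 := by omega
    rcases hm' with h | h
    · have h0 : m = 0 := (Finsupp.degree_eq_zero_iff m).1 h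
      subst h0
      simp [ha]
    · obtain ⟨k, rfl⟩ : ∃ k, m = Finsupp.single k 1 := by
        have h' : m ∈ Set.range (fun k : Fin d => Finsupp.single k 1) := by
          rw [Finsupp.range_single_one]
          exact h
        obtain ⟨k, hk⟩ := h'
        exact ⟨k, hk.symm⟩
      have h1 := congrFun (congrFun (hlin.trans linearPart_X.symm) i) k
      simpa [linearPart, sub_eq_zero] using h1
  choose g hg using fun i => exists_subst_eq ha ha' (X i)
  have hφ : ∀ i, ((g i).subst L).subst ψ.toFun = X i := fun i => by
    rw [subst_comp_subst_apply (hasSubst hL) hψ]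
    exact hg i
  have hlin' : linearPart (fun i => (g i).subst L) * linearPart ψ.toFun = 1 := by
    rw [← linearPart_subst ψ.constantCoeff_eq_zero, ← linearPart_X]
    congr 1
    exact funext hφ
  refine ⟨⟨fun i => (g i).subst L, fun i => ?_, ?_⟩, hφ⟩
  · rw [← constantCoeff_subst_eq ψ.constantCoeff_eq_zero, hφ]
    simp
  · exact (Matrix.isUnit_iff_isUnit_det _).1 (IsUnit.of_mul_eq_one _ hlin')

end Auxiliary

/-- The product of `ψ` and `φ` is the composition `ψ ∘ φ`. -/
noncomputable instance (d : ℕ) : Mul (Phylon d) where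
  mul ψ φ :=
    { toFun := fun i => (ψ.toFun i).subst φ.toFun
      constantCoeff_eq_zero := fun i => by
        rw [constantCoeff_subst_eq φ.constantCoeff_eq_zero, ψ.constantCoeff_eq_zero]
      isUnit_linearPart := by
        rw [linearPart_subst φ.constantCoeff_eq_zero, Matrix.det_mul]
        exact ψ.isUnit_linearPart.mul φ.isUnit_linearPart }

/-- The identity is `x ↦ x`. -/
noncomputable instance (d : ℕ) : One (Phylon d) where
  one :=
    { toFun := X
      constantCoeff_eq_zero := fun i => by simp
      isUnit_linearPart := by rw [linearPart_X, Matrix.det_one]; exact isUnit_one }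

/-- The inverse of `ψ` is its inverse for composition. -/
noncomputable instance (d : ℕ) : Inv (Phylon d) where
  inv ψ := (exists_left_inverse ψ).choose

lemma Phylon.mul_toFun {d : ℕ} (ψ φ : Phylon d) (i : Fin d) :
    (ψ * φ).toFun i = (ψ.toFun i).subst φ.toFun := rfl

lemma Phylon.one_toFun {d : ℕ} : (1 : Phylon d).toFun = X := rfl

/-- Under composition of formal power series, `Phylon d` is a group. -/
noncomputable instance (d : ℕ) : Group (Phylon d) :=
  Group.ofLeftAxioms
    (fun a b c => Phylon.ext (funext fun i => by
      simp only [Phylon.mul_toFun]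
      rw [subst_comp_subst_apply (hasSubst b.constantCoeff_eq_zero)
        (hasSubst c.constantCoeff_eq_zero)]
      rfl))
    (fun a => Phylon.ext (funext fun i => by
      rw [Phylon.mul_toFun, Phylon.one_toFun, subst_X (hasSubst a.constantCoeff_eq_zero)]))
    (fun a => Phylon.ext (funext fun i => by
      rw [Phylon.mul_toFun, Phylon.one_toFun]
      exact (exists_left_inverse a).choose_spec i))

/-- The quadratic form `q(x) = ‖x‖²`, as a formal power series. -/
noncomputable def normSq (d : ℕ) : Series d := ∑ i, X i ^ 2

lemma normSq_subst {d : ℕ} (ψ : Phylon d) :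
    (normSq d).subst ψ.toFun = ∑ i, ψ.toFun i ^ 2 := by
  have hs := hasSubst ψ.constantCoeff_eq_zero
  rw [normSq, ← substAlgHom_apply hs]
  simp [subst_pow hs, subst_X hs]

/-- The spherical phylon group: all `ψ` in the phylon group with `‖ψ(x)‖² = ‖x‖²`. -/
noncomputable def sphericalPhylonGroup (d : ℕ) : Subgroup (Phylon d) where
  carrier := {ψ | ∑ i, ψ.toFun i ^ 2 = normSq d}
  one_mem' := rfl
  mul_mem' {ψ φ} hψ hφ := by
    simp only [Set.mem_ofPred_eq, ← normSq_subst] at *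
    have h : (normSq d).subst (ψ * φ).toFun = ((normSq d).subst ψ.toFun).subst φ.toFun := by
      rw [subst_comp_subst_apply (hasSubst ψ.constantCoeff_eq_zero)
        (hasSubst φ.constantCoeff_eq_zero)]
      rfl
    rw [h, hψ, hφ]
  inv_mem' {ψ} hψ := by
    simp only [Set.mem_ofPred_eq, ← normSq_subst] at *
    have h : ((normSq d).subst ψ.toFun).subst (ψ⁻¹).toFun = (normSq d).subst (1 : Phylon d).toFun := by
      rw [subst_comp_subst_apply (hasSubst ψ.constantCoeff_eq_zero)
        (hasSubst (ψ⁻¹).constantCoeff_eq_zero), ← mul_inv_cancel ψ]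
      rfl
    rw [hψ, Phylon.one_toFun, subst_self] at h
    exact h

/-! ### The action on densities -/

/-- The modulus of a power series with nonzero constant term: `|a| = a` if `a(0) > 0` and
`|a| = -a` if `a(0) < 0`. -/
noncomputable def modulus {d : ℕ} (a : Series d) : Series d :=
  open Classical in if 0 < constantCoeff a then a else -a

/-- The Jacobian determinant `det (∂φ^i / ∂x^j)`. -/
noncomputable def jacobianDet {d : ℕ} (φ : Phylon d) : Series d :=
  (Matrix.of fun i j : Fin d => pderiv ℝ j (φ.toFun i)).det

/-- The action of the phylon group on densities:
`(ψ b)(x) = b(ψ⁻¹(x)) |det (∂(ψ⁻¹)^i / ∂x^j)|`. -/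
noncomputable def act {d : ℕ} (ψ : Phylon d) (b : Series d) : Series d :=
  b.subst (ψ⁻¹).toFun * modulus (jacobianDet ψ⁻¹)

/-! ### Laplace coefficients and complete traces -/

/-- The homogeneous part of degree `k` of a formal power series, as a polynomial. -/
noncomputable def homPart {d : ℕ} (k : ℕ) (f : Series d) : MvPolynomial (Fin d) ℝ :=
  MvPolynomial.homogeneousComponent k (truncTotal (k + 1) f)

/-- `f̃ = f - (1/2) f_{ij} x^i x^j`. -/
noncomputable def tildePart {d : ℕ} (f : Series d) : Series d :=
  f - (homPart 2 f : Series d)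

/-- The coefficient `Λ_i(f, b)` of `n^{-d/2} n^{-i/2}` in the Laplace expansion of
`∫ exp(-n f(x)) b(x) dx`, where `f = (1/2) f_{ij} x^i x^j + f̃` has positive definite quadratic part
and `f̃` starts in degree three. After the substitution of `n^{-1/2} x` for `x` the integrand is
`n^{-d/2} exp(-(1/2) f_{ij} x^i x^j) ∑ l, ((-n)^l / l!) (f̃^l b)(n^{-1/2} x)`,
in which the terms with `n^{-i/2}` come from the part of degree `i + 2 l` of `f̃^l b`; since
`f̃^l b` starts in degree `3 l`, only `l ≤ i` contribute. -/
noncomputable def laplaceCoeff {d : ℕ} (i : ℕ) (f b : Series d) : ℝ :=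
  ∑ l ∈ range (i + 1), (-1 : ℝ) ^ l / (l.factorial : ℝ) *
    ∫ x : Fin d → ℝ, Real.exp (-(MvPolynomial.eval x (homPart 2 f))) *
      MvPolynomial.eval x (homPart (i + 2 * l) (tildePart f ^ l * b))

/-- `Λ_i(b) = Λ_i(q, b)` with `q(x) = ‖x‖²`. -/
noncomputable def Lam {d : ℕ} (i : ℕ) (b : Series d) : ℝ := laplaceCoeff i (normSq d) b

/-- The Taylor coefficient `b_{k_1 … k_r} = ∂^r b / ∂x^{k_1} … ∂x^{k_r} (0)`, so that
`b(x) = ∑ r, (1/r!) b_{k_1 … k_r} x^{k_1} … x^{k_r}` with summation over all repeated indices. -/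
noncomputable def taylorTensor {d r : ℕ} (b : Series d) (k : Fin r → Fin d) : ℝ :=
  let m : Fin d →₀ ℕ := ∑ t, Finsupp.single (k t) 1
  (∏ i, ((m i).factorial : ℝ)) * coeff m b

/-- The complete trace: `0` if `i` is odd, and the sum of `b_{k_1 k_1 … k_j k_j}` over all
`k_1, …, k_j` if `i = 2 j`. -/
noncomputable def completeTrace {d : ℕ} (i : ℕ) (b : Series d) : ℝ :=
  if Even i then ∑ k : Fin (i / 2) → Fin d, taylorTensor b fun t : Fin (i / 2 * 2) => k t.divNat
  else 0

end FormalLaplace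

namespace FormalLaplace

open MvPowerSeries Finset

variable {d : ℕ}

/-! ### The filtration by order and the chain rule -/

/-! Since ‖x‖² is purely quadratic, Λ_i(f) is the Gaussian integral of the degree-i part of f.
Everything rests on integration by parts, Λ_i(∂_j f) = 2 Λ_{i+2}(x_j f) (`lamLinear_pderiv`). With
the Euler operator it gives Λ_i(Δf) = 2(i+2) Λ_{i+2}(f), hence the trace formula by induction. It
also shows that every Λ_i kills div Y when Y is tangent to the spheres, i.e. ∑ x_j Y_j = 0.

Conversely, for d > 1 a homogeneous series of degree k is a multiple of the radial one (zero for odd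
k) plus div(Ax) with A skew. This follows by inverting the Casimir operator of the rotations
(`exists_eq_radial_add_rot`). So in degree k the kernel of Λ_k consists exactly of tangential
divergences (`exists_eq_divergence`).

Invariance: let φ preserve ‖x‖² and have Jacobian matrix J. By the Piola identity, det J · (div Z)∘φ
= div(adj J · Z∘φ), and adj J · Z∘φ is again tangential. Powers of ‖x‖² are fixed by φ, and the
Euler derivative of det J is itself a tangential divergence. Hence pulling back multiplies each Λ_i
by det J(0) = ±1 (`lamLinear_det_mul_subst`), a sign that the modulus removes.

Existence: for skew A vanishing at 0, the Cayley transform O of A gives a spherical map x ↦ O(x)x.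
Changing A by N changes the pull-back of b by 2b(0) div(Nx) to leading order
(`cayleyPullback_sub_mem`). If b and c have equal Λ_i, invariance puts the leading part of the error
in the kernel of Λ, so it is a tangential divergence and some N removes it. The corrections have
increasing order and converge formally. -/

/-- The ideal of all formal power series of order at least `k`. -/
noncomputable def ordIdeal (d k : ℕ) : Ideal (Series d) where
  carrier := {f | (k : ℕ∞) ≤ f.order}
  add_mem' ha hb := le_trans (le_min ha hb) min_order_le_add
  zero_mem' := by simp
  smul_mem' c f hf := by
    refine le_trans ?_ le_order_mul
    exact le_trans hf le_add_self

lemma mem_ordIdeal_iff_le_order {k : ℕ} {f : Series d} :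
    f ∈ ordIdeal d k ↔ (k : ℕ∞) ≤ f.order := Iff.rfl

lemma mem_ordIdeal {k : ℕ} {f : Series d} :
    f ∈ ordIdeal d k ↔ ∀ m : Fin d →₀ ℕ, m.degree < k → coeff m f = 0 :=
  ⟨fun h m hm => coeff_of_lt_order (lt_of_lt_of_le (by exact_mod_cast hm) h),
    fun h => nat_le_order h⟩

lemma mul_mem_ordIdeal {k l : ℕ} {f g : Series d} (hf : f ∈ ordIdeal d k)
    (hg : g ∈ ordIdeal d l) : f * g ∈ ordIdeal d (k + l) := by
  refine le_trans ?_ le_order_mul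
  push_cast
  exact add_le_add hf hg

lemma ordIdeal_anti {k l : ℕ} (h : k ≤ l) : ordIdeal d l ≤ ordIdeal d k :=
  fun f (hf : (l : ℕ∞) ≤ f.order) => le_trans (Nat.cast_le.2 h) hf

lemma mem_ordIdeal_zero (f : Series d) : f ∈ ordIdeal d 0 := by simp [mem_ordIdeal]

lemma mem_ordIdeal_one {f : Series d} : f ∈ ordIdeal d 1 ↔ constantCoeff f = 0 := by
  rw [mem_ordIdeal_iff_le_order, Nat.cast_one, one_le_order_iff_constCoeff_eq_zero]

lemma X_mem_ordIdeal_one (i : Fin d) : (X i : Series d) ∈ ordIdeal d 1 := by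
  simp [mem_ordIdeal_one]

lemma smul_mem_ordIdeal {k : ℕ} {f : Series d} (r : ℝ) (hf : f ∈ ordIdeal d k) :
    r • f ∈ ordIdeal d k := by
  rw [smul_eq_C_mul]
  exact Ideal.mul_mem_left _ _ hf

lemma eq_of_forall_sub_mem_ordIdeal {f g : Series d} (h : ∀ k, f - g ∈ ordIdeal d k) : f = g := by
  ext m
  have := mem_ordIdeal.1 (h (m.degree + 1)) m (by omega)
  rwa [map_sub, sub_eq_zero] at this

lemma pderiv_mem_ordIdeal {k : ℕ} {f : Series d} (hf : f ∈ ordIdeal d (k + 1)) (i : Fin d) :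
    pderiv ℝ i f ∈ ordIdeal d k := by
  refine mem_ordIdeal.2 fun m hm => ?_
  rw [coeff_pderiv, mem_ordIdeal.1 hf _ (by simp [hm]), zero_mul]

lemma subst_mem_ordIdeal {a : Fin d → Series d} (ha : ∀ i, constantCoeff (a i) = 0) {k : ℕ}
    {f : Series d} (hf : f ∈ ordIdeal d k) : f.subst a ∈ ordIdeal d k :=
  le_trans hf (order_le_order_subst ha f)

lemma sub_truncTotal_mem_ordIdeal (f : Series d) (k : ℕ) :
    f - (truncTotal k f : Series d) ∈ ordIdeal d k := by
  refine mem_ordIdeal.2 fun m hm => ?_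
  rw [map_sub, MvPolynomial.coeff_coe, coeff_truncTotal _ hm, sub_self]

lemma sub_homogeneousComponent_mem_ordIdeal {f : Series d} {k : ℕ} (hf : f ∈ ordIdeal d k) :
    f - homogeneousComponent k f ∈ ordIdeal d (k + 1) := by
  refine mem_ordIdeal.2 fun m hm => ?_
  rw [map_sub, coeff_homogeneousComponent]
  split_ifs with h
  · simp
  · rw [mem_ordIdeal.1 hf m (by omega), sub_zero]

/-- For polynomials this is congruence modulo an ideal; the tail of `f` beyond degree `k` stays in
the ideal after substitution. -/
lemma subst_sub_subst_mem {a a' : Fin d → Series d} (ha : ∀ i, constantCoeff (a i) = 0)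
    (ha' : ∀ i, constantCoeff (a' i) = 0) {k : ℕ} (h : ∀ i, a i - a' i ∈ ordIdeal d k)
    (f : Series d) : f.subst a - f.subst a' ∈ ordIdeal d k := by
  have hp : ∀ p : MvPolynomial (Fin d) ℝ,
      (p : Series d).subst a - (p : Series d).subst a' ∈ ordIdeal d k := by
    intro p
    rw [subst_coe, subst_coe]
    induction p using MvPolynomial.induction_on with
    | C r => simp
    | add p q hp hq => simpa [add_sub_add_comm] using add_mem hp hq
    | mul_X p i hp =>
      rw [map_mul, map_mul, MvPolynomial.aeval_X, MvPolynomial.aeval_X]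
      have e : ∀ u v w z : Series d, u * v - w * z = (u - w) * v + w * (v - z) := fun _ _ _ _ => by
        ring
      rw [e]
      exact add_mem (Ideal.mul_mem_right _ _ hp) (Ideal.mul_mem_left _ _ (h i))
  have hr := sub_truncTotal_mem_ordIdeal f k
  have e : f.subst a - f.subst a' =
      ((truncTotal k f : Series d).subst a - (truncTotal k f : Series d).subst a') +
      ((f - (truncTotal k f : Series d)).subst a - (f - (truncTotal k f : Series d)).subst a') := by
    rw [subst_sub (hasSubst ha), subst_sub (hasSubst ha')]
    ring
  rw [e]
  exact add_mem (hp _) (sub_mem (subst_mem_ordIdeal ha hr) (subst_mem_ordIdeal ha' hr))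

/-- The chain rule for the composition of formal power series. -/
lemma pderiv_subst {a : Fin d → Series d} (ha : ∀ i, constantCoeff (a i) = 0) (j : Fin d)
    (f : Series d) :
    pderiv ℝ j (f.subst a) = ∑ i, (pderiv ℝ i f).subst a * pderiv ℝ j (a i) := by
  classical
  have hs := hasSubst ha
  have hp : ∀ p : MvPolynomial (Fin d) ℝ, pderiv ℝ j ((p : Series d).subst a) =
      ∑ i, (pderiv ℝ i (p : Series d)).subst a * pderiv ℝ j (a i) := by
    intro p
    induction p using MvPolynomial.induction_on with
    | C r =>
      rw [MvPolynomial.coe_C, subst_C]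
      simp only [pderiv_C, ← substAlgHom_apply hs, map_zero, zero_mul, sum_const_zero]
    | add p q hp hq =>
      simp only [MvPolynomial.coe_add, ← substAlgHom_apply hs, map_add, add_mul,
        sum_add_distrib] at *
      rw [hp, hq]
    | mul_X p l hp =>
      simp only [MvPolynomial.coe_mul, MvPolynomial.coe_X, ← substAlgHom_apply hs, map_mul,
        map_add, Derivation.leibniz, smul_eq_mul, substAlgHom_X hs] at *
      rw [hp]
      simp only [add_mul, sum_add_distrib, mul_sum]
      congr 1
      · rw [Finset.sum_eq_single l]
        · rw [pderiv_X_self, map_one, mul_one]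
        · intro i _ hi
          rw [pderiv_X_of_ne (Ne.symm hi), map_zero, mul_zero, zero_mul]
        · simp
      · exact sum_congr rfl fun i _ => by ring
  -- Both sides are continuous for the order filtration. Truncation is at `k + 1` because
  -- differentiation loses one order.
  refine eq_of_forall_sub_mem_ordIdeal fun k => ?_
  have hr := sub_truncTotal_mem_ordIdeal f (k + 1)
  set p := truncTotal (k + 1) f
  have e : pderiv ℝ j (f.subst a) - ∑ i, (pderiv ℝ i f).subst a * pderiv ℝ j (a i) =
      pderiv ℝ j ((f - (p : Series d)).subst a) -
        ∑ i, (pderiv ℝ i (f - (p : Series d))).subst a * pderiv ℝ j (a i) := by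
    simp only [subst_sub hs, map_sub, sub_mul, sum_sub_distrib, hp]
    ring
  rw [e]
  refine sub_mem (pderiv_mem_ordIdeal (subst_mem_ordIdeal ha hr) _) (sum_mem fun i _ => ?_)
  exact Ideal.mul_mem_right _ _ (subst_mem_ordIdeal ha (pderiv_mem_ordIdeal hr i))

lemma pderiv_comm (i j : Fin d) (f : Series d) :
    pderiv ℝ i (pderiv ℝ j f) = pderiv ℝ j (pderiv ℝ i f) := by
  classical
  ext m
  simp only [coeff_pderiv, Finsupp.add_apply]
  rcases eq_or_ne i j with rfl | h
  · rfl
  · rw [Finsupp.single_eq_of_ne h, Finsupp.single_eq_of_ne h.symm, add_right_comm]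
    simp only [add_zero]
    ring

/-- The Euler derivation `∑ x^j ∂_j`. -/
noncomputable def euler (d : ℕ) : Derivation ℝ (Series d) (Series d) :=
  ∑ j, (X j : Series d) • pderiv ℝ j

lemma euler_apply (f : Series d) : euler d f = ∑ j, X j * pderiv ℝ j f := by
  have h := map_sum (⟨⟨fun D : Derivation ℝ (Series d) (Series d) => D f, rfl⟩, fun _ _ => rfl⟩ :
    Derivation ℝ (Series d) (Series d) →+ Series d) (fun j => (X j : Series d) • pderiv ℝ j) univ
  exact h

lemma coeff_X_mul_pderiv (j : Fin d) (f : Series d) (m : Fin d →₀ ℕ) :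
    coeff m (X j * pderiv ℝ j f) = m j * coeff m f := by
  classical
  rw [X_def, coeff_monomial_mul]
  split_ifs with h
  · rw [coeff_pderiv, tsub_add_cancel_of_le h]
    have : 1 ≤ m j := by simpa using h j
    simp only [Finsupp.tsub_apply, Finsupp.single_eq_same, one_mul, Nat.cast_sub this]
    push_cast
    ring
  · have : m j = 0 := by
      rw [Finsupp.single_le_iff] at h
      omega
    simp [this]

lemma coeff_euler (f : Series d) (m : Fin d →₀ ℕ) :
    coeff m (euler d f) = m.degree * coeff m f := by
  rw [euler_apply, map_sum]
  simp only [coeff_X_mul_pderiv]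
  rw [← sum_mul, Finsupp.degree_eq_sum]
  push_cast
  rfl

lemma euler_homogeneousComponent (k : ℕ) (f : Series d) :
    euler d (homogeneousComponent k f) = (k : ℝ) • homogeneousComponent k f := by
  ext m
  rw [coeff_euler, coeff_smul, coeff_homogeneousComponent]
  split_ifs with h
  · rw [h]
  · simp

lemma euler_pderiv (j : Fin d) (f : Series d) :
    euler d (pderiv ℝ j f) = pderiv ℝ j (euler d f) - pderiv ℝ j f := by
  ext m
  simp only [map_sub, coeff_euler, coeff_pderiv, map_add, Finsupp.degree_single]
  push_cast
  ring

lemma euler_X (i : Fin d) : euler d (X i) = X i := by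
  rw [euler_apply, Finset.sum_eq_single i]
  · simp
  · intro j _ hj
    rw [pderiv_X_of_ne hj.symm, mul_zero]
  · simp

lemma euler_normSq : euler d (normSq d) = (2 : ℝ) • normSq d := by
  simp only [normSq, map_sum, smul_sum]
  refine sum_congr rfl fun i _ => ?_
  rw [sq, Derivation.leibniz, euler_X, smul_eq_mul, smul_eq_C_mul]
  rw [map_ofNat]
  ring

lemma pderiv_normSq (j : Fin d) : pderiv ℝ j (normSq d) = 2 * X j := by
  simp only [normSq, map_sum]
  rw [Finset.sum_eq_single j]
  · rw [pderiv_pow]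
    simp
  · intro i _ hi
    rw [pderiv_pow, pderiv_X_of_ne hi, mul_zero]
  · simp

/-! ### Jacobi's formula, first order expansion of determinants and the Piola identity -/

lemma derivation_prod {ι R A : Type*} [DecidableEq ι] [CommRing R] [CommRing A] [Algebra R A]
    (D : Derivation R A A) (s : Finset ι) (f : ι → A) :
    D (∏ i ∈ s, f i) = ∑ i ∈ s, (∏ j ∈ s.erase i, f j) * D (f i) := by
  induction s using Finset.induction_on with
  | empty => simp
  | insert a s ha ih =>
    rw [prod_insert ha, Derivation.leibniz, ih, sum_insert ha, erase_insert ha, smul_eq_mul,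
      smul_eq_mul, mul_sum, add_comm]
    congr 1
    refine sum_congr rfl fun i hi => ?_
    rw [erase_insert_of_ne (by rintro rfl; exact ha hi),
      prod_insert (fun h => ha (mem_of_mem_erase h)), mul_assoc]

/-- Jacobi's formula. -/
lemma derivation_det {n R A : Type*} [Fintype n] [DecidableEq n] [CommRing R] [CommRing A]
    [Algebra R A] (D : Derivation R A A) (M : Matrix n n A) :
    D M.det = (M.adjugate * M.map D).trace := by
  -- By Cramer's rule each diagonal entry is the determinant with one column differentiated.
  have h : ∀ i, (M.adjugate * M.map D) i i = (M.updateCol i fun k => D (M k i)).det := by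
    intro i
    rw [← Matrix.cramer_apply, Matrix.cramer_eq_adjugate_mulVec]
    rfl
  rw [Matrix.trace]
  simp only [Matrix.diag_apply, h, Matrix.det_apply, map_sum]
  rw [sum_comm]
  refine sum_congr rfl fun σ _ => ?_
  rw [← smul_sum]
  have : ∀ x : A, D (Equiv.Perm.sign σ • x) = Equiv.Perm.sign σ • D x := by
    intro x
    rw [Units.smul_def, Units.smul_def, map_zsmul]
  rw [this, derivation_prod]
  congr 1
  refine sum_congr rfl fun i _ => ?_
  rw [← mul_prod_erase univ _ (mem_univ i), mul_comm]
  congr 1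
  · simp
  · refine prod_congr rfl fun j hj => ?_
    rw [Matrix.updateCol_ne (ne_of_mem_erase hj)]

/-- The rows of `P` are switched on one at a time. Vanishing products turn each new row into a
rank-one factor `1 + E`, whose determinant is known. -/
lemma det_one_add_of_mul_eq_zero {n A : Type*} [Fintype n] [DecidableEq n] [CommRing A]
    (P : Matrix n n A) (h : ∀ i j k l, P i j * P k l = 0) : (1 + P).det = 1 + P.trace := by
  have key : ∀ s : Finset n, (1 + Matrix.of fun i j => if i ∈ s then P i j else 0).det =
      1 + ∑ i ∈ s, P i i := by
    intro s
    induction s using Finset.induction_on with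
    | empty =>
      have : (Matrix.of fun i j => if i ∈ (∅ : Finset n) then P i j else 0) = 0 := by
        ext; simp
      rw [this]; simp
    | insert a s ha ih =>
      set Q : Matrix n n A := Matrix.of fun i j => if i ∈ s then P i j else 0
      set E : Matrix n n A := Matrix.replicateCol Unit (Pi.single a (1 : A)) *
        Matrix.replicateRow Unit (fun j => P a j) with hE
      have hEij : ∀ i j, E i j = if i = a then P a j else 0 := by
        intro i j
        simp [hE, Matrix.mul_apply, Pi.single_apply]
      have hdet : (1 + E).det = 1 + P a a := by
        rw [hE, Matrix.det_one_add_replicateCol_mul_replicateRow]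
        simp
      have hQE : Q * E = 0 := by
        ext i j
        rw [Matrix.mul_apply]
        refine sum_eq_zero fun k _ => ?_
        rw [hEij]
        by_cases hi : i ∈ s <;> by_cases hk : k = a <;> simp [Q, hi, hk, h]
      have e : (1 + Matrix.of fun i j => if i ∈ insert a s then P i j else 0) =
          (1 + Q) * (1 + E) := by
        rw [add_mul, one_mul, mul_add, mul_one, hQE, add_zero, add_assoc]
        congr 1
        ext i j
        simp only [Matrix.of_apply, Matrix.add_apply, hEij, Q, mem_insert]
        by_cases hi : i = a
        · subst hi; simp [ha]
        · simp [hi]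
      rw [e, Matrix.det_mul, ih, hdet, sum_insert ha, mul_add, mul_one, add_mul, sum_mul,
        sum_eq_zero (f := fun i => P i i * P a a) (fun i _ => h _ _ _ _)]
      ring
  have e : (Matrix.of fun i j => if i ∈ (univ : Finset n) then P i j else 0) = P := by
    ext; simp
  have := key univ
  rwa [e] at this

lemma det_one_add_sub_mem {n A : Type*} [Fintype n] [DecidableEq n] [CommRing A] (K : Ideal A)
    (P : Matrix n n A) (h : ∀ i j k l, P i j * P k l ∈ K) :
    (1 + P).det - (1 + P.trace) ∈ K := by
  rw [← Ideal.Quotient.eq]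
  have := det_one_add_of_mul_eq_zero (P.map (Ideal.Quotient.mk K)) (fun i j k l => by
    rw [Matrix.map_apply, Matrix.map_apply, ← map_mul]
    exact Ideal.Quotient.eq_zero_iff_mem.2 (h i j k l))
  rw [RingHom.map_det, map_add, map_one, map_add, map_one]
  refine this.trans (congrArg (1 + ·) ?_)
  exact (map_sum (Ideal.Quotient.mk K) (fun i => P i i) univ).symm

/-- Factor M + N = M(1 + M⁻¹N). Quadratic terms in M⁻¹N have order 2k ≥ k + 1, and adj M is 1 modulo
order one, so tr(adj M · N) may be replaced by tr N. -/
lemma det_add_sub_det_mem {k : ℕ} (hk : 1 ≤ k) (M N : Matrix (Fin d) (Fin d) (Series d))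
    (hM : constantCoeff.mapMatrix M = 1) (hN : ∀ i j, N i j ∈ ordIdeal d k) :
    (M + N).det - M.det - N.trace ∈ ordIdeal d (k + 1) := by
  have hdet : constantCoeff M.det = 1 := by rw [RingHom.map_det, hM, Matrix.det_one]
  have hunit : IsUnit M.det := isUnit_iff_constantCoeff.2 (by rw [hdet]; exact isUnit_one)
  have hadj : constantCoeff.mapMatrix (M.adjugate - 1) = 0 := by
    rw [map_sub, RingHom.map_adjugate, hM, map_one, Matrix.adjugate_one, sub_self]
  have hadj' : ∀ i j, (M.adjugate - 1) i j ∈ ordIdeal d 1 := fun i j =>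
    mem_ordIdeal_one.2 (congrFun (congrFun hadj i) j)
  have hP : ∀ i j, (M⁻¹ * N) i j ∈ ordIdeal d k := fun i j => by
    rw [Matrix.mul_apply]
    exact sum_mem fun l _ => Ideal.mul_mem_left _ _ (hN l j)
  have h1 := det_one_add_sub_mem (ordIdeal d (k + 1)) (M⁻¹ * N) fun i j i' j' =>
    ordIdeal_anti (by omega) (mul_mem_ordIdeal (hP i j) (hP i' j'))
  have h2 : (M + N).det = M.det * (1 + M⁻¹ * N).det := by
    rw [← Matrix.det_mul, mul_add, mul_one, ← mul_assoc, Matrix.mul_nonsing_inv _ hunit, one_mul]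
  have h3 : M.det * (M⁻¹ * N).trace = ((M.adjugate - 1) * N).trace + N.trace := by
    rw [sub_mul, one_mul, Matrix.trace_sub, sub_add_cancel, ← smul_eq_mul, ← Matrix.trace_smul,
      ← Matrix.smul_mul]
    congr 2
    rw [Matrix.inv_def, smul_smul, Ring.mul_inverse_cancel _ hunit, one_smul]
  have e : (M + N).det - M.det - N.trace =
      M.det * ((1 + M⁻¹ * N).det - (1 + (M⁻¹ * N).trace)) + ((M.adjugate - 1) * N).trace := by
    rw [mul_sub, ← h2, mul_add, h3]
    ring
  rw [e]
  refine add_mem (Ideal.mul_mem_left _ _ h1) (sum_mem fun i _ => ?_)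
  rw [Matrix.diag_apply, Matrix.mul_apply]
  refine sum_mem fun l _ => ?_
  rw [add_comm k 1]
  exact mul_mem_ordIdeal (hadj' i l) (hN l i)

/-- The divergence of a formal vector field. -/
noncomputable def divergence (Y : Fin d → Series d) : Series d := ∑ j, pderiv ℝ j (Y j)

/-- The Jacobian matrix of a formal map. -/
noncomputable def jacobian (φ : Fin d → Series d) : Matrix (Fin d) (Fin d) (Series d) :=
  Matrix.of fun i j => pderiv ℝ j (φ i)

lemma jacobian_apply (φ : Fin d → Series d) (i j : Fin d) :
    jacobian φ i j = pderiv ℝ j (φ i) := rfl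

/-- The Piola identity. -/
lemma sum_pderiv_adjugate_jacobian (φ : Fin d → Series d) (h : (jacobian φ).det ≠ 0)
    (i : Fin d) : ∑ j, pderiv ℝ j ((jacobian φ).adjugate j i) = 0 := by
  set M := jacobian φ with hM
  set v : Fin d → Series d := fun i => ∑ j, pderiv ℝ j (M.adjugate j i) with hv
  -- Differentiate adj M · M = det M · 1 and sum. By symmetry of second derivatives, the part with
  -- derivatives of `M` is Jacobi's formula for ∂_l det M and cancels the right-hand side.
  have hvM : Matrix.vecMul v M = 0 := by
    ext1 l
    have h1 : ∀ j, ∑ i, (pderiv ℝ j (M.adjugate j i) * M i l + M.adjugate j i *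
        pderiv ℝ j (M i l)) = if j = l then pderiv ℝ j M.det else 0 := by
      intro j
      have := congrArg (pderiv ℝ j) (congrFun (congrFun (Matrix.adjugate_mul M) j) l)
      rw [Matrix.mul_apply, map_sum] at this
      simp only [Derivation.leibniz, smul_eq_mul, Matrix.smul_apply, Matrix.one_apply] at this
      rw [sum_congr rfl fun i _ => show _ = _ from ?_, this]
      · split_ifs <;> simp
      · ring
    have h2 := Finset.sum_congr (rfl : (univ : Finset (Fin d)) = univ) fun j _ => h1 j
    simp only [sum_add_distrib, Finset.sum_ite_eq', mem_univ, if_true] at h2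
    have h3 : ∑ j, ∑ i, M.adjugate j i * pderiv ℝ j (M i l) = pderiv ℝ l M.det := by
      rw [derivation_det, Matrix.trace]
      refine sum_congr rfl fun j _ => ?_
      rw [Matrix.diag_apply, Matrix.mul_apply]
      refine sum_congr rfl fun i _ => ?_
      rw [Matrix.map_apply, hM, jacobian_apply, jacobian_apply, pderiv_comm]
    rw [h3, add_eq_right] at h2
    rw [Matrix.vecMul, dotProduct, Pi.zero_apply, ← h2, sum_comm]
    simp only [hv, sum_mul]
  have h4 := congrArg (fun w => Matrix.vecMul w M.adjugate) hvM
  simp only [Matrix.vecMul_vecMul, Matrix.mul_adjugate, Matrix.zero_vecMul,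
    Matrix.vecMul_smul, Matrix.vecMul_one] at h4
  have h5 := congrFun h4 i
  simp only [Pi.smul_apply, smul_eq_mul, Pi.zero_apply, mul_eq_zero] at h5
  exact h5.resolve_left h

/-- In the product rule the terms that differentiate the adjugate sum to zero by the Piola identity.
-/
lemma divergence_adjugate_mulVec (φ V : Fin d → Series d) (h : (jacobian φ).det ≠ 0) :
    divergence ((jacobian φ).adjugate.mulVec V) =
      ((jacobian φ).adjugate * jacobian V).trace := by
  have h1 : ∀ j, pderiv ℝ j ((jacobian φ).adjugate.mulVec V j) =
      ∑ i, (jacobian φ).adjugate j i * pderiv ℝ j (V i) +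
      ∑ i, V i * pderiv ℝ j ((jacobian φ).adjugate j i) := by
    intro j
    rw [Matrix.mulVec, dotProduct, map_sum, ← sum_add_distrib]
    exact sum_congr rfl fun i _ => by rw [Derivation.leibniz, smul_eq_mul, smul_eq_mul]
  rw [divergence, sum_congr rfl fun j _ => h1 j, sum_add_distrib, Matrix.trace]
  rw [sum_comm (f := fun j i => V i * pderiv ℝ j ((jacobian φ).adjugate j i))]
  simp only [← mul_sum, sum_pderiv_adjugate_jacobian φ h, mul_zero, sum_const_zero, add_zero]
  rfl

/-! ### Gaussian moments -/

section GaussianMoments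

open MeasureTheory

lemma integrable_pow_mul_exp_neg_sq (n : ℕ) :
    Integrable (fun x : ℝ => x ^ n * Real.exp (-x ^ 2)) := by
  have h := integrable_rpow_mul_exp_neg_mul_sq (b := 1) one_pos (s := (n : ℝ))
    (lt_of_lt_of_le (by norm_num) (Nat.cast_nonneg n))
  simpa [Real.rpow_natCast] using h

/-- The `n`-th moment of `exp (-x²)`. -/
noncomputable def gaussMoment (n : ℕ) : ℝ := ∫ x : ℝ, x ^ n * Real.exp (-x ^ 2)

/-- The derivative of x^n exp(-x²) has integral zero. For `n = 0` the truncated `n - 1` is harmless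
because of the factor `n`. -/
lemma gaussMoment_succ (n : ℕ) : 2 * gaussMoment (n + 1) = n * gaussMoment (n - 1) := by
  have hd : ∀ x : ℝ, HasDerivAt (fun x : ℝ => x ^ n * Real.exp (-x ^ 2))
      (n * (x ^ (n - 1) * Real.exp (-x ^ 2)) - 2 * (x ^ (n + 1) * Real.exp (-x ^ 2))) x := by
    intro x
    have h1 := hasDerivAt_pow n x
    have h2 : HasDerivAt (fun x : ℝ => Real.exp (-x ^ 2)) (Real.exp (-x ^ 2) * -(2 * x)) x := by
      simpa using ((hasDerivAt_pow 2 x).neg).exp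
    exact (h1.mul h2).congr_deriv (by ring)
  have hi1 := (integrable_pow_mul_exp_neg_sq (n - 1)).const_mul (n : ℝ)
  have hi2 := (integrable_pow_mul_exp_neg_sq (n + 1)).const_mul 2
  have h := integral_eq_zero_of_hasDerivAt_of_integrable hd (hi1.sub hi2)
    (integrable_pow_mul_exp_neg_sq n)
  rw [integral_sub hi1 hi2, integral_const_mul, integral_const_mul] at h
  exact (sub_eq_zero.1 h).symm

lemma exp_neg_sum_sq_mul_eval_monomial (α : Fin d →₀ ℕ) (a : ℝ) (x : Fin d → ℝ) :
    Real.exp (-∑ i, x i ^ 2) * MvPolynomial.eval x (MvPolynomial.monomial α a) =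
      a * ∏ i, x i ^ α i * Real.exp (-x i ^ 2) := by
  rw [MvPolynomial.eval_monomial, prod_mul_distrib, ← Real.exp_sum, sum_neg_distrib,
    Finsupp.prod_fintype _ _ (by simp)]
  ring

lemma integrable_exp_neg_sum_sq_mul_eval (p : MvPolynomial (Fin d) ℝ) :
    Integrable fun x : Fin d → ℝ => Real.exp (-∑ i, x i ^ 2) * MvPolynomial.eval x p := by
  induction p using MvPolynomial.induction_on' with
  | monomial α a =>
    simp only [exp_neg_sum_sq_mul_eval_monomial]
    exact (Integrable.fintype_prod fun i => integrable_pow_mul_exp_neg_sq (α i)).const_mul a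
  | add p q hp hq =>
    simp only [map_add, mul_add]
    exact hp.add hq

/-- The integral of a polynomial against `exp (-‖x‖²)`. -/
noncomputable def gaussIntegral (d : ℕ) : MvPolynomial (Fin d) ℝ →ₗ[ℝ] ℝ where
  toFun p := ∫ x : Fin d → ℝ, Real.exp (-∑ i, x i ^ 2) * MvPolynomial.eval x p
  map_add' p q := by
    rw [← integral_add (integrable_exp_neg_sum_sq_mul_eval p)
      (integrable_exp_neg_sum_sq_mul_eval q)]
    simp only [map_add, mul_add]
  map_smul' r p := by
    rw [RingHom.id_apply, smul_eq_mul, ← integral_const_mul]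
    simp only [MvPolynomial.smul_eval]
    congr 1
    ext x
    ring

lemma gaussIntegral_monomial (α : Fin d →₀ ℕ) (a : ℝ) :
    gaussIntegral d (MvPolynomial.monomial α a) = a * ∏ i, gaussMoment (α i) := by
  change (∫ x : Fin d → ℝ, Real.exp (-∑ i, x i ^ 2) *
    MvPolynomial.eval x (MvPolynomial.monomial α a)) = _
  simp only [exp_neg_sum_sq_mul_eval_monomial]
  rw [integral_const_mul,
    integral_fintype_prod_volume_eq_prod (fun i (t : ℝ) => t ^ α i * Real.exp (-t ^ 2))]
  rfl

/-- Gaussian integration by parts. -/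
lemma gaussIntegral_pderiv (j : Fin d) (p : MvPolynomial (Fin d) ℝ) :
    gaussIntegral d (MvPolynomial.pderiv j p) = 2 * gaussIntegral d (MvPolynomial.X j * p) := by
  induction p using MvPolynomial.induction_on' with
  | monomial α a =>
    rw [MvPolynomial.pderiv_monomial, MvPolynomial.X, MvPolynomial.monomial_mul, one_mul,
      gaussIntegral_monomial, gaussIntegral_monomial, ← mul_prod_erase univ (fun i => gaussMoment ((α - Finsupp.single j 1 : Fin d →₀ ℕ) i)) (mem_univ j),
      ← mul_prod_erase univ (fun i => gaussMoment ((Finsupp.single j 1 + α : Fin d →₀ ℕ) i)) (mem_univ j)]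
    have h : ∏ i ∈ univ.erase j, gaussMoment ((α - Finsupp.single j 1 : Fin d →₀ ℕ) i) =
        ∏ i ∈ univ.erase j, gaussMoment ((Finsupp.single j 1 + α : Fin d →₀ ℕ) i) := by
      refine prod_congr rfl fun i hi => ?_
      have : Finsupp.single j 1 i = 0 := Finsupp.single_eq_of_ne (ne_of_mem_erase hi)
      rw [Finsupp.tsub_apply, Finsupp.add_apply, this, zero_add, tsub_zero]
    rw [h, Finsupp.tsub_apply, Finsupp.add_apply, Finsupp.single_eq_same, add_comm 1]
    have := gaussMoment_succ (α j)
    linear_combination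
      (-a * ∏ i ∈ univ.erase j, gaussMoment ((Finsupp.single j 1 + α : Fin d →₀ ℕ) i)) * this
  | add p q hp hq => rw [map_add, map_add, hp, hq, mul_add, map_add, mul_add]

lemma gaussIntegral_one : gaussIntegral d 1 = Real.pi ^ ((d : ℝ) / 2) := by
  have h : (1 : MvPolynomial (Fin d) ℝ) = MvPolynomial.monomial 0 1 := rfl
  have h0 : gaussMoment 0 = Real.sqrt Real.pi := by
    have := integral_gaussian 1
    simpa [gaussMoment] using this
  rw [h, gaussIntegral_monomial]
  simp only [Finsupp.coe_zero, Pi.zero_apply, h0, prod_const, card_univ, Fintype.card_fin, one_mul]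
  rw [Real.sqrt_eq_rpow, ← Real.rpow_natCast, ← Real.rpow_mul Real.pi_pos.le]
  congr 1
  ring

end GaussianMoments

/-! ### The Laplace coefficients as linear functionals -/

lemma coeff_homPart (k : ℕ) (f : Series d) (m : Fin d →₀ ℕ) :
    (homPart k f).coeff m = if m.degree = k then coeff m f else 0 := by
  rw [homPart, MvPolynomial.coeff_homogeneousComponent]
  split_ifs with h
  · rw [coeff_truncTotal _ (by omega)]
  · rfl

lemma homPart_coe {k : ℕ} {p : MvPolynomial (Fin d) ℝ} (hp : p.IsHomogeneous k) :
    homPart k (p : Series d) = p := by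
  ext m
  rw [coeff_homPart, MvPolynomial.coeff_coe]
  split_ifs with h
  · rfl
  · exact (hp.coeff_eq_zero h).symm

lemma homPart_two_normSq : homPart 2 (normSq d) = ∑ i, MvPolynomial.X i ^ 2 := by
  have h : normSq d = ((∑ i, MvPolynomial.X i ^ 2 : MvPolynomial (Fin d) ℝ) : Series d) := by
    rw [← MvPolynomial.coeToMvPowerSeries.ringHom_apply, map_sum]
    simp [normSq]
  rw [h, homPart_coe]
  exact MvPolynomial.IsHomogeneous.sum _ _ _ fun i _ => MvPolynomial.isHomogeneous_X_pow i 2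

lemma tildePart_normSq : tildePart (normSq d) = 0 := by
  rw [tildePart, homPart_two_normSq, ← MvPolynomial.coeToMvPowerSeries.ringHom_apply, map_sum]
  simp [normSq]

/-- `Λ_i` as a linear functional. -/
noncomputable def lamLinear (d i : ℕ) : Series d →ₗ[ℝ] ℝ :=
  gaussIntegral d ∘ₗ MvPolynomial.homogeneousComponent i ∘ₗ truncTotal (i + 1)

lemma lamLinear_apply (i : ℕ) (f : Series d) :
    lamLinear d i f = gaussIntegral d (homPart i f) := rfl

/-- ‖x‖² has no part beyond its quadratic one, so only the term `l = 0` survives. -/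
lemma Lam_eq_lamLinear (i : ℕ) (f : Series d) : Lam i f = lamLinear d i f := by
  rw [Lam, laplaceCoeff, sum_eq_single 0]
  · rw [lamLinear_apply, homPart_two_normSq]
    simp [gaussIntegral]
  · intro l _ hl
    have : homPart (i + 2 * l) (0 : Series d) = 0 := by
      ext m
      simp [coeff_homPart]
    rw [tildePart_normSq, zero_pow hl, zero_mul, this]
    simp
  · simp

lemma lamLinear_eq_zero_of_mem {i : ℕ} {f : Series d} (hf : f ∈ ordIdeal d (i + 1)) :
    lamLinear d i f = 0 := by
  have : homPart i f = 0 := by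
    ext m
    rw [coeff_homPart]
    split_ifs with h
    · rw [mem_ordIdeal.1 hf m (by omega), MvPolynomial.coeff_zero]
    · rfl
  rw [lamLinear_apply, this, map_zero]

lemma lamLinear_homogeneousComponent (i : ℕ) (f : Series d) :
    lamLinear d i (homogeneousComponent i f) = lamLinear d i f := by
  rw [lamLinear_apply, lamLinear_apply]
  congr 1
  ext m
  simp only [coeff_homPart, coeff_homogeneousComponent]
  split_ifs <;> rfl

lemma homPart_X_mul (i : ℕ) (j : Fin d) (f : Series d) :
    homPart (i + 1) (X j * f) = MvPolynomial.X j * homPart i f := by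
  classical
  ext m
  rw [coeff_homPart, X_def, coeff_monomial_mul, MvPolynomial.X, MvPolynomial.coeff_monomial_mul',
    coeff_homPart]
  by_cases hj : Finsupp.single j 1 ≤ m
  · have hm : m.degree = (m - Finsupp.single j 1).degree + 1 := by
      conv_lhs => rw [← tsub_add_cancel_of_le hj]
      simp
    simp only [hj, if_true, one_mul]
    congr 1
    simp [hm]
  · simp [hj]

lemma homPart_pderiv (i : ℕ) (j : Fin d) (f : Series d) :
    homPart i (pderiv ℝ j f) = MvPolynomial.pderiv j (homPart (i + 1) f) := by
  ext m
  rw [coeff_homPart, MvPolynomial.coeff_pderiv, coeff_homPart, coeff_pderiv]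
  simp

lemma lamLinear_pderiv (i : ℕ) (j : Fin d) (f : Series d) :
    lamLinear d i (pderiv ℝ j f) = 2 * lamLinear d (i + 2) (X j * f) := by
  rw [lamLinear_apply, lamLinear_apply, homPart_pderiv, gaussIntegral_pderiv,
    show i + 2 = (i + 1) + 1 from rfl, homPart_X_mul]

lemma lamLinear_zero (f : Series d) :
    lamLinear d 0 f = Real.pi ^ ((d : ℝ) / 2) * constantCoeff f := by
  have : homPart 0 f = constantCoeff f • 1 := by
    ext m
    rw [coeff_homPart, MvPolynomial.coeff_smul, MvPolynomial.coeff_one]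
    simp only [Finsupp.degree_eq_zero_iff]
    by_cases h : m = 0
    · subst h; simp
    · simp [h, Ne.symm h]
  rw [lamLinear_apply, this, map_smul, gaussIntegral_one, smul_eq_mul, mul_comm]

/-- Λ_i sees only degree i, where the Euler operator is multiplication by i. -/
lemma lamLinear_euler (i : ℕ) (f : Series d) :
    lamLinear d i (euler d f) = i * lamLinear d i f := by
  rw [← smul_eq_mul, ← map_smul, ← lamLinear_homogeneousComponent,
    ← lamLinear_homogeneousComponent i ((i : ℝ) • f)]
  congr 1
  ext m
  rw [coeff_homogeneousComponent, coeff_homogeneousComponent, coeff_smul, coeff_euler]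
  split_ifs with h
  · rw [h]
  · rfl

/-- Base case for odd degrees: by Euler's formula it concerns x_j times a constant, and integration
by parts differentiates that constant. -/
lemma lamLinear_one (f : Series d) : lamLinear d 1 f = 0 := by
  have h := lamLinear_euler 1 f
  rw [Nat.cast_one, one_mul] at h
  rw [← h, euler_apply, map_sum]
  refine sum_eq_zero fun j _ => ?_
  have h0 : MvPolynomial.pderiv j (homPart 0 (pderiv ℝ j f)) = 0 := by
    ext m
    rw [MvPolynomial.coeff_pderiv, coeff_homPart]
    simp
  have h1 := gaussIntegral_pderiv j (homPart 0 (pderiv ℝ j f))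
  rw [h0, map_zero] at h1
  rw [lamLinear_apply, homPart_X_mul 0]
  linarith

/-- The Laplace operator on formal power series. -/
noncomputable def laplacian (f : Series d) : Series d := ∑ j, pderiv ℝ j (pderiv ℝ j f)

lemma lamLinear_add_two (i : ℕ) (f : Series d) :
    lamLinear d i (laplacian f) = 2 * (i + 2) * lamLinear d (i + 2) f := by
  have h := lamLinear_euler (i + 2) f
  rw [laplacian, map_sum]
  simp only [lamLinear_pderiv]
  rw [← mul_sum, ← map_sum, ← euler_apply, h]
  push_cast
  ring

/-- Integration by parts applied to ∑ ∂_j(x_j f) = d f + (Euler operator of f). -/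
lemma lamLinear_normSq_mul (i : ℕ) (f : Series d) :
    2 * lamLinear d (i + 2) (normSq d * f) = (d + i) * lamLinear d i f := by
  have h : lamLinear d i (∑ j, pderiv ℝ j (X j * f)) =
      2 * lamLinear d (i + 2) (∑ j, X j * (X j * f)) := by
    rw [map_sum, map_sum, mul_sum]
    exact sum_congr rfl fun j _ => lamLinear_pderiv i j _
  have h1 : ∑ j, X j * (X j * f) = normSq d * f := by
    rw [normSq, sum_mul]
    exact sum_congr rfl fun j _ => by ring
  have h2 : ∑ j, pderiv ℝ j (X j * f) = (d : ℝ) • f + euler d f := by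
    simp only [Derivation.leibniz, pderiv_X_self, smul_eq_mul, sum_add_distrib, euler_apply]
    simp [smul_eq_C_mul, add_comm]
  rw [h1, h2, map_add, map_smul, lamLinear_euler, smul_eq_mul] at h
  linarith

/-- The divergence of a vector field tangent to the spheres is annihilated by all `Λ_i`. -/
lemma lamLinear_divergence {Y : Fin d → Series d} (hY : ∑ j, X j * Y j = 0) (i : ℕ) :
    lamLinear d i (divergence Y) = 0 := by
  rw [divergence, map_sum]
  simp only [lamLinear_pderiv]
  rw [← mul_sum, ← map_sum, hY, map_zero, mul_zero]

/-! ### Complete traces -/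

/-- The derivative of order `m` at the origin. -/
noncomputable def derivAtZero (m : Fin d →₀ ℕ) (f : Series d) : ℝ :=
  (∏ i, ((m i).factorial : ℝ)) * coeff m f

lemma derivAtZero_add_single (m : Fin d →₀ ℕ) (i : Fin d) (f : Series d) :
    derivAtZero (m + Finsupp.single i 1) f = derivAtZero m (pderiv ℝ i f) := by
  rw [derivAtZero, derivAtZero, coeff_pderiv, ← mul_prod_erase univ _ (mem_univ i),
    ← mul_prod_erase univ (fun j => ((m j).factorial : ℝ)) (mem_univ i)]
  have h : ∏ j ∈ univ.erase i, (((m + Finsupp.single i 1 : Fin d →₀ ℕ) j).factorial : ℝ) =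
      ∏ j ∈ univ.erase i, ((m j).factorial : ℝ) := by
    refine prod_congr rfl fun j hj => ?_
    rw [Finsupp.add_apply, Finsupp.single_eq_of_ne (ne_of_mem_erase hj), add_zero]
  rw [h, Finsupp.add_apply, Finsupp.single_eq_same, Nat.factorial_succ]
  push_cast
  ring

/-- The complete trace of order `2 * j`. -/
noncomputable def evenTrace (j : ℕ) (f : Series d) : ℝ :=
  ∑ k : Fin j → Fin d, taylorTensor f fun t : Fin (j * 2) => k t.divNat

lemma evenTrace_eq (j : ℕ) (f : Series d) :
    evenTrace j f = ∑ k : Fin j → Fin d, derivAtZero (∑ s, Finsupp.single (k s) 2) f := by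
  refine sum_congr rfl fun k _ => ?_
  -- An index `t` is a pair in `Fin j × Fin 2` and `divNat` forgets the second entry, so each `k s`
  -- occurs twice.
  have h : ∑ t : Fin (j * 2), Finsupp.single (k t.divNat) 1 = ∑ s, Finsupp.single (k s) 2 := by
    rw [Fintype.sum_equiv finProdFinEquiv.symm (fun t : Fin (j * 2) =>
      Finsupp.single (k t.divNat) 1) (fun s => Finsupp.single (k s.1) 1) (fun t => rfl),
      Fintype.sum_prod_type]
    refine sum_congr rfl fun s _ => ?_
    rw [Fin.sum_univ_two, ← Finsupp.single_add]
  rw [taylorTensor, ← h]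
  rfl

lemma evenTrace_zero (f : Series d) : evenTrace 0 f = constantCoeff f := by
  rw [evenTrace_eq]
  simp [derivAtZero]

/-- Splitting off the first index, the sum over it of repeated second derivatives is the Laplacian.
-/
lemma evenTrace_succ (j : ℕ) (f : Series d) : evenTrace (j + 1) f = evenTrace j (laplacian f) := by
  have hsum : ∀ m : Fin d →₀ ℕ, derivAtZero m (laplacian f) =
      ∑ i, derivAtZero m (pderiv ℝ i (pderiv ℝ i f)) := fun m => by
    rw [derivAtZero, laplacian, map_sum, mul_sum]
    rfl
  rw [evenTrace_eq, evenTrace_eq, Fintype.sum_equiv (Fin.consEquiv fun _ : Fin (j + 1) => Fin d).symm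
    (fun k => derivAtZero (∑ s, Finsupp.single (k s) 2) f)
    (fun q => derivAtZero (Finsupp.single q.1 2 + ∑ s, Finsupp.single (q.2 s) 2) f)
    (fun k => by rw [Fin.sum_univ_succ]; rfl), Fintype.sum_prod_type, sum_comm]
  refine sum_congr rfl fun k _ => ?_
  rw [hsum]
  refine sum_congr rfl fun i _ => ?_
  have h2 : (Finsupp.single i 2 : Fin d →₀ ℕ) = Finsupp.single i 1 + Finsupp.single i 1 := by
    rw [← Finsupp.single_add]
  rw [add_comm, h2, ← add_assoc, derivAtZero_add_single, derivAtZero_add_single]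

/-- Both sides are reduced to the Laplacian of `f`; each step divides by 2(2j + 2) = 4(j + 1), which
builds up j! · 2^(2j). -/
lemma lamLinear_two_mul (j : ℕ) (f : Series d) :
    lamLinear d (2 * j) f =
      Real.pi ^ ((d : ℝ) / 2) / ((j.factorial : ℝ) * 2 ^ (2 * j)) * evenTrace j f := by
  induction j generalizing f with
  | zero => simp [lamLinear_zero, evenTrace_zero]
  | succ j ih =>
    have h := lamLinear_add_two (2 * j) f
    rw [ih] at h
    rw [evenTrace_succ, show 2 * (j + 1) = 2 * j + 2 from rfl, Nat.factorial_succ]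
    push_cast at h ⊢
    have h0 : (2 * ((2 : ℝ) * j + 2)) ≠ 0 := by positivity
    rw [← mul_right_inj' h0, ← h, pow_add]
    have h1 : (j.factorial : ℝ) ≠ 0 := by positivity
    have h2 : (j : ℝ) + 1 ≠ 0 := by positivity
    field_simp

lemma lamLinear_two_mul_add_one (j : ℕ) (f : Series d) : lamLinear d (2 * j + 1) f = 0 := by
  induction j generalizing f with
  | zero => exact lamLinear_one f
  | succ j ih =>
    have h := lamLinear_add_two (2 * j + 1) f
    rw [ih] at h
    have h0 : (2 * (((2 * j + 1 : ℕ) : ℝ) + 2)) ≠ 0 := by positivity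
    exact (mul_eq_zero.1 h.symm).resolve_left h0

/-- The Laplace coefficients in terms of complete traces. -/
lemma Lam_eq_completeTrace (i : ℕ) (f : Series d) :
    Lam i f = Real.pi ^ ((d : ℝ) / 2) / (((i / 2).factorial : ℝ) * 2 ^ i) *
      completeTrace i f := by
  rw [Lam_eq_lamLinear]
  rcases Nat.even_or_odd' i with ⟨j, rfl | rfl⟩
  · have h : 2 * j / 2 = j := by omega
    rw [completeTrace, if_pos (even_two_mul j), lamLinear_two_mul]
    change _ = _ * evenTrace (2 * j / 2) f
    rw [h]
  · rw [completeTrace, if_neg (by simp), mul_zero, lamLinear_two_mul_add_one]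

/-! ### Infinitesimal rotations and the decomposition of homogeneous series -/

/-- The infinitesimal rotation `x^j ∂_l - x^l ∂_j`. -/
noncomputable def rot (j l : Fin d) : Derivation ℝ (Series d) (Series d) :=
  (X j : Series d) • pderiv ℝ l - (X l : Series d) • pderiv ℝ j

lemma rot_apply (j l : Fin d) (f : Series d) :
    rot j l f = X j * pderiv ℝ l f - X l * pderiv ℝ j f := rfl

lemma rot_normSq (j l : Fin d) : rot j l (normSq d) = 0 := by
  rw [rot_apply, pderiv_normSq, pderiv_normSq]
  ring

lemma rot_normSq_mul (j l : Fin d) (f : Series d) :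
    rot j l (normSq d * f) = normSq d * rot j l f := by
  rw [Derivation.leibniz, rot_normSq, smul_zero, add_zero, smul_eq_mul]

lemma rot_mem_ordIdeal {k : ℕ} {f : Series d} (hf : f ∈ ordIdeal d k) (j l : Fin d) :
    rot j l f ∈ ordIdeal d k := by
  rcases k with _ | k
  · exact mem_ordIdeal_zero _
  · have h : ∀ j l : Fin d, X j * pderiv ℝ l f ∈ ordIdeal d (k + 1) := fun j l => by
      rw [add_comm]
      exact mul_mem_ordIdeal (X_mem_ordIdeal_one j) (pderiv_mem_ordIdeal hf l)
    exact sub_mem (h j l) (h l j)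

lemma normSq_mem_ordIdeal : normSq d ∈ ordIdeal d 2 :=
  sum_mem fun i _ => by
    rw [sq]
    exact mul_mem_ordIdeal (X_mem_ordIdeal_one i) (X_mem_ordIdeal_one i)

lemma pderiv_X_eq_ite (l j : Fin d) :
    pderiv ℝ l (X j : Series d) = if l = j then 1 else 0 := by
  split_ifs with h
  · rw [h, pderiv_X_self]
  · exact pderiv_X_of_ne (Ne.symm h)

lemma euler_euler (f : Series d) :
    euler d (euler d f) = euler d f + ∑ j, ∑ l, X j * X l * pderiv ℝ j (pderiv ℝ l f) := by
  have h : ∀ j, X j * pderiv ℝ j (euler d f) =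
      X j * pderiv ℝ j f + ∑ l, X j * X l * pderiv ℝ j (pderiv ℝ l f) := by
    intro j
    simp only [euler_apply, map_sum, Derivation.leibniz, smul_eq_mul, pderiv_X_eq_ite, mul_ite,
      mul_one, mul_zero, sum_add_distrib, sum_ite_eq, mem_univ, if_true, mul_add]
    rw [add_comm, mul_sum]
    simp only [mul_assoc]
  rw [euler_apply, sum_congr rfl fun j _ => h j, sum_add_distrib, ← euler_apply]

/-- The Casimir identity for infinitesimal rotations. -/
lemma sum_rot_rot (f : Series d) :
    ∑ j, ∑ l, rot j l (rot j l f) =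
      2 * (normSq d * laplacian f - euler d (euler d f) - ((d : Series d) - 2) * euler d f) := by
  -- `T` is half of the expansion: the square of each rotation is `T j l + T l j`, so the double sum
  -- is twice that of `T`.
  let T : Fin d → Fin d → Series d := fun j l => (if l = j then X j * pderiv ℝ l f else 0)
    + X j ^ 2 * pderiv ℝ l (pderiv ℝ l f) - X j * pderiv ℝ j f
    - X j * X l * pderiv ℝ j (pderiv ℝ l f)
  have h : ∀ j l : Fin d, rot j l (rot j l f) = T j l + T l j := by
    intro j l
    simp only [T, rot_apply, map_sub, Derivation.leibniz, smul_eq_mul, pderiv_X_self,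
      pderiv_X_eq_ite, pderiv_comm l j]
    by_cases hjl : l = j
    · subst hjl
      simp only [if_true]
      ring
    · simp only [hjl, Ne.symm hjl, if_false]
      ring
  have e1 : ∑ j, ∑ l, T j l = euler d f + normSq d * laplacian f - d * euler d f
        - ∑ j, ∑ l, X j * X l * pderiv ℝ j (pderiv ℝ l f) := by
    simp only [T, sum_add_distrib, sum_sub_distrib, sum_ite_eq', mem_univ, if_true]
    rw [← euler_apply]
    congr 2
    · rw [normSq, laplacian, sum_mul_sum]
    · simp only [sum_const, card_univ, Fintype.card_fin, nsmul_eq_mul, ← mul_sum, euler_apply]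
  have e2 : ∑ j, ∑ l, T l j = ∑ j, ∑ l, T j l := sum_comm
  simp only [h, sum_add_distrib]
  rw [e2, e1, euler_euler]
  ring

lemma coeff_eq_zero_of_euler {k : ℕ} {f : Series d} (hf : euler d f = (k : ℝ) • f)
    {m : Fin d →₀ ℕ} (hm : m.degree ≠ k) : coeff m f = 0 := by
  have h := congrArg (coeff m) hf
  rw [coeff_euler, coeff_smul, ← sub_eq_zero, ← sub_mul, mul_eq_zero, sub_eq_zero] at h
  exact h.resolve_left (by exact_mod_cast hm)

lemma mem_ordIdeal_of_euler {k : ℕ} {f : Series d} (hf : euler d f = (k : ℝ) • f) :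
    f ∈ ordIdeal d k :=
  mem_ordIdeal.2 fun _ hm => coeff_eq_zero_of_euler hf hm.ne

lemma euler_laplacian {k : ℝ} {f : Series d} (hf : euler d f = k • f) :
    euler d (laplacian f) = (k - 2) • laplacian f := by
  rw [laplacian, map_sum, smul_sum]
  refine sum_congr rfl fun j _ => ?_
  rw [euler_pderiv, euler_pderiv, hf, map_sub, Derivation.map_smul, Derivation.map_smul, sub_smul, two_smul]
  ring

/-- The rotation invariant homogeneous series of degree `k`. -/
noncomputable def radial (d k : ℕ) : Series d := if Even k then normSq d ^ (k / 2) else 0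

lemma radial_add_two (k : ℕ) : radial d (k + 2) = normSq d * radial d k := by
  rw [radial, radial, Nat.add_div_right _ two_pos, pow_succ']
  have h : Even (k + 2) ↔ Even k := by simp [Nat.even_add]
  simp only [h]
  split_ifs <;> simp

/-- Homogeneous series are rotation invariant up to images of infinitesimal rotations. -/
lemma exists_eq_radial_add_rot (hd : 1 < d) (k : ℕ) (f : Series d)
    (hf : euler d f = (k : ℝ) • f) :
    ∃ (a : ℝ) (B : Matrix (Fin d) (Fin d) (Series d)), (∀ j l, B j l ∈ ordIdeal d k) ∧
      f = a • radial d k + ∑ j, ∑ l, rot j l (B j l) := by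
  induction k using Nat.strong_induction_on generalizing f with
  | _ k ih =>
    rcases k with _ | k
    · refine ⟨constantCoeff f, 0, fun j l => zero_mem _, ?_⟩
      simp only [radial, Even.zero, if_true, Matrix.zero_apply, map_zero, sum_const_zero, add_zero]
      ext m
      by_cases h : m = 0
      · subst h; simp
      · rw [coeff_eq_zero_of_euler hf (by rwa [Ne, Finsupp.degree_eq_zero_iff])]
        simp [coeff_one, h]
    · have hmem := mem_ordIdeal_of_euler hf
      obtain ⟨a, B, hB, hrep⟩ : ∃ (a : ℝ) (B : Matrix (Fin d) (Fin d) (Series d)),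
          (∀ j l, B j l ∈ ordIdeal d (k + 1)) ∧
          normSq d * laplacian f = a • radial d (k + 1) + ∑ j, ∑ l, rot j l (B j l) := by
        rcases k with _ | k
        · refine ⟨0, 0, fun j l => zero_mem _, ?_⟩
          -- Here `f` has degree one, so its Laplacian would be homogeneous of degree -1.
          have h0 : laplacian f = 0 := by
            ext m
            have h := congrArg (coeff m) (euler_laplacian hf)
            rw [coeff_euler, coeff_smul, ← sub_eq_zero, ← sub_mul, mul_eq_zero] at h
            refine h.resolve_left ?_
            push_cast
            have : (0 : ℝ) ≤ m.degree := Nat.cast_nonneg _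
            intro h
            linarith
          simp [h0]
        · obtain ⟨a, B, hB, hrep⟩ := ih k (by omega) (laplacian f) (by
            rw [euler_laplacian hf]
            congr 1
            push_cast
            ring)
          refine ⟨a, fun j l => normSq d * B j l, fun j l => ?_, ?_⟩
          · rw [show k + 1 + 1 = 2 + k by ring]
            exact mul_mem_ordIdeal normSq_mem_ordIdeal (hB j l)
          · simp only [rot_normSq_mul, ← mul_sum]
            rw [radial_add_two, ← mul_smul_comm, ← mul_add, ← hrep]
      have hcas := sum_rot_rot f
      have hd' : (2 : ℝ) ≤ d := by exact_mod_cast hd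
      -- The Casimir eigenvalue in degree `k + 1`. It is nonzero because `d > 1`; for `d = 1` it
      -- would vanish in degree one.
      set c : ℝ := (k + 1) * (k + 1 + d - 2) with hc
      have hc0 : c ≠ 0 := by
        have : (0 : ℝ) ≤ k := Nat.cast_nonneg _
        have h1 : 0 < (k : ℝ) + 1 + d - 2 := by linarith
        positivity
      have hfc : c • f = normSq d * laplacian f - (2⁻¹ : ℝ) • ∑ j, ∑ l, rot j l (rot j l f) := by
        rw [hcas, hf, Derivation.map_smul, hf]
        simp only [smul_eq_C_mul, hc]
        have h2 : (C (2⁻¹ : ℝ) : Series d) * 2 = 1 := by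
          rw [← map_ofNat (C : ℝ →+* Series d) 2, ← map_mul]
          norm_num
        simp only [map_mul, map_sub, map_add, map_natCast, map_ofNat, map_one]
        push_cast
        linear_combination (normSq d * laplacian f - ((k : Series d) + 1) * (((k : Series d) + 1) * f)
          - ((d : Series d) - 2) * (((k : Series d) + 1) * f)) * h2
      refine ⟨c⁻¹ * a, fun j l => c⁻¹ • (B j l - (2⁻¹ : ℝ) • rot j l f), fun j l => ?_, ?_⟩
      · exact smul_mem_ordIdeal _ (sub_mem (hB j l)
          (smul_mem_ordIdeal _ (rot_mem_ordIdeal hmem j l)))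
      · simp only [Derivation.map_smul, map_sub, ← smul_sum, sum_sub_distrib]
        rw [mul_smul, ← smul_add, ← add_sub_assoc, ← hrep, ← hfc, smul_smul, inv_mul_cancel₀ hc0,
          one_smul]

/-- Sums of rotations become divergences of fields Ax with A skew. Differentiating the factor x
contributes only the diagonal of A, which is zero. -/
lemma divergence_transpose_sub_mulVec_X (B : Matrix (Fin d) (Fin d) (Series d)) :
    divergence ((B.transpose - B).mulVec X) = ∑ j, ∑ l, rot j l (B j l) := by
  have h : ∀ l, pderiv ℝ l ((B.transpose - B).mulVec X l) =
      ∑ j, (X j * pderiv ℝ l (B j l) - X j * pderiv ℝ l (B l j)) := by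
    intro l
    rw [Matrix.mulVec, dotProduct, map_sum]
    refine sum_congr rfl fun j _ => ?_
    rw [Derivation.leibniz, smul_eq_mul, smul_eq_mul, Matrix.sub_apply, Matrix.transpose_apply,
      pderiv_X_eq_ite, map_sub]
    split_ifs with h
    · subst h; ring
    · ring
  rw [divergence, sum_congr rfl fun l _ => h l]
  simp only [rot_apply, sum_sub_distrib]
  congr 1
  exact sum_comm

/-- Tangency to the spheres: transposing shows that the form equals its own negative. -/
lemma X_dotProduct_mulVec_X {A : Matrix (Fin d) (Fin d) (Series d)} (hA : A.transpose = -A) :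
    ∑ j, X j * A.mulVec X j = 0 := by
  have h1 : (X : Fin d → Series d) ⬝ᵥ A.mulVec X = -((X : Fin d → Series d) ⬝ᵥ A.mulVec X) := by
    conv_lhs => rw [Matrix.dotProduct_mulVec, ← Matrix.mulVec_transpose, hA, Matrix.neg_mulVec,
      neg_dotProduct, dotProduct_comm]
  have h2 : (2 : ℝ) • ((X : Fin d → Series d) ⬝ᵥ A.mulVec X) = 0 := by
    rw [two_smul]
    exact add_eq_zero_iff_eq_neg.2 h1
  exact (smul_eq_zero.1 h2).resolve_left two_ne_zero

/-- Homogeneous series are rotation invariant up to divergences of tangential vector fields. -/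
lemma exists_eq_radial_add_divergence (hd : 1 < d) (k : ℕ) (f : Series d)
    (hf : euler d f = (k : ℝ) • f) :
    ∃ (a : ℝ) (A : Matrix (Fin d) (Fin d) (Series d)), A.transpose = -A ∧
      (∀ j l, A j l ∈ ordIdeal d k) ∧ f = a • radial d k + divergence (A.mulVec X) := by
  obtain ⟨a, B, hB, h⟩ := exists_eq_radial_add_rot hd k f hf
  refine ⟨a, B.transpose - B, ?_, fun j l => sub_mem (hB l j) (hB j l), ?_⟩
  · rw [Matrix.transpose_sub, Matrix.transpose_transpose, neg_sub]
  · rw [divergence_transpose_sub_mulVec_X, h]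

/-- Starting from π^(d/2), multiplying by ‖x‖² scales by a nonzero factor. Hence Λ_k detects the
radial coefficient. -/
lemma lamLinear_radial_ne_zero (hd : 0 < d) {k : ℕ} (hk : Even k) :
    lamLinear d k (radial d k) ≠ 0 := by
  obtain ⟨j, rfl⟩ := even_iff_exists_two_mul.1 hk
  induction j with
  | zero =>
    rw [mul_zero, lamLinear_zero]
    simp only [radial, Even.zero, if_true, Nat.zero_div, pow_zero, map_one, mul_one]
    positivity
  | succ j ih =>
    rw [show 2 * (j + 1) = 2 * j + 2 from rfl, radial_add_two]
    have h := lamLinear_normSq_mul (2 * j) (radial d (2 * j))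
    have h1 : (d : ℝ) + (2 * j : ℕ) ≠ 0 := by positivity
    intro h0
    rw [h0, mul_zero] at h
    exact (mul_ne_zero h1 (ih (even_two_mul j))) h.symm

/-- A homogeneous series of degree `k` annihilated by `Λ_k` is the divergence of a tangential
vector field. -/
lemma exists_eq_divergence (hd : 1 < d) {k : ℕ} {f : Series d} (hf : euler d f = (k : ℝ) • f)
    (h : lamLinear d k f = 0) :
    ∃ A : Matrix (Fin d) (Fin d) (Series d), A.transpose = -A ∧
      (∀ j l, A j l ∈ ordIdeal d k) ∧ f = divergence (A.mulVec X) := by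
  obtain ⟨a, A, hA, hmem, hrep⟩ := exists_eq_radial_add_divergence hd k f hf
  refine ⟨A, hA, hmem, ?_⟩
  have h0 : a • radial d k = 0 := by
    by_cases hk : Even k
    · rw [hrep, map_add, map_smul, lamLinear_divergence (X_dotProduct_mulVec_X hA), add_zero,
        smul_eq_mul, mul_eq_zero] at h
      rw [h.resolve_right (lamLinear_radial_ne_zero (by omega) hk), zero_smul]
    · rw [radial, if_neg hk, smul_zero]
  rwa [h0, zero_add] at hrep

/-! ### Invariance of the Laplace coefficients -/

section Invariance

variable {φ : Fin d → Series d}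

/-- The gradient of ‖φ‖² = ‖x‖², halved. -/
lemma jacobian_transpose_mulVec (h : ∑ i, φ i ^ 2 = normSq d) :
    (jacobian φ).transpose.mulVec φ = X := by
  ext1 j
  have h1 := congrArg (pderiv ℝ j) h
  simp only [map_sum, pderiv_pow, pderiv_normSq] at h1
  have h2 : (2 : ℝ) • (jacobian φ).transpose.mulVec φ j = (2 : ℝ) • X j := by
    rw [smul_eq_C_mul, smul_eq_C_mul, map_ofNat, ← h1, Matrix.mulVec, dotProduct, mul_sum]
    refine sum_congr rfl fun i _ => ?_
    rw [Matrix.transpose_apply, jacobian_apply]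
    push_cast
    ring
  exact smul_right_injective _ (two_ne_zero (α := ℝ)) h2

lemma linearPart_eq (φ : Fin d → Series d) :
    linearPart φ = constantCoeff.mapMatrix (jacobian φ) := by
  ext i j
  simp only [linearPart, Matrix.of_apply, RingHom.mapMatrix_apply, Matrix.map_apply,
    jacobian_apply]
  rw [← coeff_zero_eq_constantCoeff_apply, coeff_pderiv]
  simp

/-- Differentiating Jᵀφ = x at the origin shows that the linear part is orthogonal. -/
lemma constantCoeff_det_jacobian_sq (h0 : ∀ i, constantCoeff (φ i) = 0)
    (h : ∑ i, φ i ^ 2 = normSq d) : constantCoeff (jacobian φ).det ^ 2 = 1 := by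
  classical
  have h1 : (linearPart φ).transpose * linearPart φ = 1 := by
    ext i j
    have h2 := congrArg (fun v : Fin d → Series d => constantCoeff (pderiv ℝ j (v i)))
      (jacobian_transpose_mulVec h)
    rw [linearPart_eq]
    simp only [Matrix.mulVec, dotProduct, map_sum, map_add, map_mul, Derivation.leibniz,
      smul_eq_mul, h0, zero_mul, add_zero, Matrix.transpose_apply, pderiv_X_eq_ite] at h2
    rw [Matrix.mul_apply, Matrix.one_apply]
    simp only [Matrix.transpose_apply, RingHom.mapMatrix_apply, Matrix.map_apply]
    rw [show (if i = j then (1 : ℝ) else 0) = constantCoeff (if j = i then (1 : Series d) else 0) by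
      simp only [eq_comm (a := i)]; split_ifs <;> simp, ← h2]
    exact sum_congr rfl fun l _ => by simp [jacobian_apply]
  have h3 := congrArg Matrix.det h1
  rw [Matrix.det_mul, Matrix.det_transpose, Matrix.det_one, linearPart_eq,
    ← RingHom.map_det] at h3
  rw [sq, h3]

/-- Substitute x = Jᵀφ and use J · adj J = det J. The use: if φ · V = 0, then adj J · V is tangent
to the spheres. -/
lemma sum_X_mul_adjugate_mulVec (h : ∑ i, φ i ^ 2 = normSq d) (V : Fin d → Series d) :
    ∑ j, X j * (jacobian φ).adjugate.mulVec V j = (jacobian φ).det * ∑ i, φ i * V i := by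
  change (X : Fin d → Series d) ⬝ᵥ (jacobian φ).adjugate.mulVec V =
    (jacobian φ).det * (φ ⬝ᵥ V)
  rw [← jacobian_transpose_mulVec h, Matrix.mulVec_transpose, ← Matrix.dotProduct_mulVec,
    Matrix.mulVec_mulVec, Matrix.mul_adjugate, Matrix.smul_mulVec, Matrix.one_mulVec,
    dotProduct_smul, smul_eq_mul]

lemma jacobian_subst (h0 : ∀ i, constantCoeff (φ i) = 0) (Z : Fin d → Series d) :
    jacobian (fun i => (Z i).subst φ) =
      (Matrix.of fun i j => (pderiv ℝ j (Z i)).subst φ) * jacobian φ := by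
  ext1 i j
  rw [jacobian_apply, pderiv_subst h0, Matrix.mul_apply]
  rfl

lemma divergence_adjugate_mulVec_subst (h0 : ∀ i, constantCoeff (φ i) = 0)
    (hJ : (jacobian φ).det ≠ 0) (Z : Fin d → Series d) :
    divergence ((jacobian φ).adjugate.mulVec fun i => (Z i).subst φ) =
      (jacobian φ).det * (divergence Z).subst φ := by
  rw [divergence_adjugate_mulVec φ _ hJ, jacobian_subst h0, ← mul_assoc, Matrix.trace_mul_comm,
    ← mul_assoc, Matrix.mul_adjugate, Matrix.smul_mul, one_mul, Matrix.trace_smul, smul_eq_mul,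
    ← substAlgHom_apply (hasSubst h0), divergence, map_sum]
  simp only [substAlgHom_apply]
  rfl

/-- Jacobi's formula, together with the commutator of the Euler operator with ∂_j, which produces
the correction `- φ i`. The field vanishes for linear φ. -/
lemma euler_det_jacobian (hJ : (jacobian φ).det ≠ 0) :
    euler d (jacobian φ).det =
      divergence ((jacobian φ).adjugate.mulVec fun i => euler d (φ i) - φ i) := by
  rw [divergence_adjugate_mulVec φ _ hJ, derivation_det]
  congr 2
  ext1 i j
  rw [Matrix.map_apply, jacobian_apply, jacobian_apply, euler_pderiv, map_sub]

lemma sum_mul_euler_sub (h : ∑ i, φ i ^ 2 = normSq d) :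
    ∑ i, φ i * (euler d (φ i) - φ i) = 0 := by
  have h1 := congrArg (euler d) h
  rw [euler_normSq, ← h, map_sum] at h1
  have h2 : (2 : ℝ) • ∑ i, φ i * (euler d (φ i) - φ i) = 0 := by
    rw [← sub_eq_zero] at h1
    rw [← h1, smul_sum, smul_sum, ← sum_sub_distrib]
    refine sum_congr rfl fun i _ => ?_
    rw [sq, Derivation.leibniz, smul_eq_C_mul, smul_eq_C_mul, map_ofNat, smul_eq_mul]
    ring
  exact (smul_eq_zero.1 h2).resolve_left two_ne_zero

lemma det_jacobian_ne_zero (h0 : ∀ i, constantCoeff (φ i) = 0) (h : ∑ i, φ i ^ 2 = normSq d) :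
    (jacobian φ).det ≠ 0 := by
  intro hJ
  have := constantCoeff_det_jacobian_sq h0 h
  rw [hJ, map_zero] at this
  norm_num at this

/-- For `m = 0`, i Λ_i(det J) is Λ_i of a tangential divergence, so only degree zero contributes.
For larger `m` both sides obey the recursion `lamLinear_normSq_mul`. -/
lemma lamLinear_normSq_pow_mul_det (h0 : ∀ i, constantCoeff (φ i) = 0)
    (h : ∑ i, φ i ^ 2 = normSq d) (m i : ℕ) :
    lamLinear d i (normSq d ^ m * (jacobian φ).det) =
      constantCoeff (jacobian φ).det * lamLinear d i (normSq d ^ m) := by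
  induction m generalizing i with
  | zero =>
    rcases i with _ | i
    · simp only [pow_zero, one_mul, lamLinear_zero, map_one]
      ring
    · have hi : ((i + 1 : ℕ) : ℝ) ≠ 0 := by positivity
      have h1 : lamLinear d (i + 1) (jacobian φ).det = 0 := by
        have e := lamLinear_euler (i + 1) (jacobian φ).det
        rw [euler_det_jacobian (det_jacobian_ne_zero h0 h), lamLinear_divergence
          (by rw [sum_X_mul_adjugate_mulVec h, sum_mul_euler_sub h, mul_zero])] at e
        exact (mul_eq_zero.1 e.symm).resolve_left hi
      have h2 : lamLinear d (i + 1) 1 = 0 := by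
        have e := lamLinear_euler (d := d) (i + 1) 1
        rw [Derivation.map_one_eq_zero, map_zero] at e
        exact (mul_eq_zero.1 e.symm).resolve_left hi
      rw [pow_zero, one_mul, h1, h2, mul_zero]
  | succ m ih =>
    have hlt : ∀ g : Series d, ∀ i < 2, lamLinear d i (normSq d * g) = 0 := fun g i hi =>
      lamLinear_eq_zero_of_mem
        (Ideal.mul_mem_right _ _ (ordIdeal_anti (by omega) normSq_mem_ordIdeal))
    rw [pow_succ', mul_assoc]
    rcases lt_or_ge i 2 with hi | hi
    · rw [hlt _ i hi, hlt _ i hi, mul_zero]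
    · obtain ⟨i, rfl⟩ := Nat.exists_eq_add_of_le' hi
      have h1 := lamLinear_normSq_mul i (normSq d ^ m * (jacobian φ).det)
      have h2 := lamLinear_normSq_mul i (normSq d ^ m)
      rw [ih] at h1
      linear_combination h1 / 2 - constantCoeff (jacobian φ).det / 2 * h2

lemma subst_normSq_pow (h0 : ∀ i, constantCoeff (φ i) = 0) (h : ∑ i, φ i ^ 2 = normSq d) (m : ℕ) :
    (normSq d ^ m).subst φ = normSq d ^ m := by
  have h1 : (normSq d).subst φ = normSq d := by
    conv_rhs => rw [← h]
    rw [normSq, ← substAlgHom_apply (hasSubst h0), map_sum]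
    simp only [map_pow, substAlgHom_X (hasSubst h0)]
  rw [subst_pow (hasSubst h0), h1]

/-- Change of variables for the Laplace coefficients. -/
lemma lamLinear_det_mul_subst (hd : 1 < d) (h0 : ∀ i, constantCoeff (φ i) = 0)
    (h : ∑ i, φ i ^ 2 = normSq d) (i : ℕ) (b : Series d) :
    lamLinear d i ((jacobian φ).det * b.subst φ) =
      constantCoeff (jacobian φ).det * lamLinear d i b := by
  have hs := hasSubst h0
  have hJ := det_jacobian_ne_zero h0 h
  have hrad : ∀ k, lamLinear d i ((jacobian φ).det * (radial d k).subst φ) =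
      constantCoeff (jacobian φ).det * lamLinear d i (radial d k) := by
    intro k
    rw [radial]
    split_ifs with hk
    · rw [subst_normSq_pow h0 h, mul_comm, lamLinear_normSq_pow_mul_det h0 h]
    · rw [← substAlgHom_apply hs, map_zero, mul_zero, map_zero, mul_zero]
  -- Substituting φ into x · Z = 0 gives φ · (Z∘φ) = 0, so the adjugate makes the pulled-back field
  -- tangential.
  have hdiv : ∀ Z : Fin d → Series d, ∑ j, X j * Z j = 0 →
      lamLinear d i ((jacobian φ).det * (divergence Z).subst φ) = 0 := by
    intro Z hZ
    rw [← divergence_adjugate_mulVec_subst h0 hJ, lamLinear_divergence]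
    rw [sum_X_mul_adjugate_mulVec h]
    have := congrArg (substAlgHom hs) hZ
    simp only [map_sum, map_mul, substAlgHom_X hs, map_zero] at this
    simp only [substAlgHom_apply] at this
    rw [this, mul_zero]
  have hhom : ∀ k, lamLinear d i ((jacobian φ).det * (homogeneousComponent k b).subst φ) =
      constantCoeff (jacobian φ).det * lamLinear d i (homogeneousComponent k b) := by
    intro k
    obtain ⟨a, A, hA, -, hrep⟩ := exists_eq_radial_add_divergence hd k _
      (euler_homogeneousComponent k b)
    have hX := X_dotProduct_mulVec_X hA
    rw [hrep, subst_add hs, subst_smul hs, mul_add, map_add, map_add, hdiv _ hX,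
      lamLinear_divergence hX, add_zero, add_zero, mul_smul_comm, map_smul, map_smul, hrad,
      smul_eq_mul, smul_eq_mul]
    ring
  have hr := sub_truncTotal_mem_ordIdeal b (i + 1)
  have hb : b = ∑ k ∈ range (i + 1), homogeneousComponent k b
      + (b - (truncTotal (i + 1) b : Series d)) := by
    rw [truncTotal_eq_sum]
    ring
  rw [hb, subst_add hs, mul_add, map_add, map_add, lamLinear_eq_zero_of_mem hr,
    lamLinear_eq_zero_of_mem (Ideal.mul_mem_left _ _ (subst_mem_ordIdeal h0 hr)), add_zero,
    add_zero]
  simp only [← substAlgHom_apply hs, map_sum, mul_sum] at hhom ⊢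
  exact sum_congr rfl fun k _ => hhom k

end Invariance

lemma mem_sphericalPhylonGroup {ψ : Phylon d} :
    ψ ∈ sphericalPhylonGroup d ↔ ∑ i, ψ.toFun i ^ 2 = normSq d := Iff.rfl

/-- The Laplace coefficients are invariant under the spherical phylon group. -/
lemma lamLinear_act (hd : 1 < d) {ψ : Phylon d} (hψ : ψ ∈ sphericalPhylonGroup d) (b : Series d)
    (i : ℕ) : lamLinear d i (act ψ b) = lamLinear d i b := by
  have h0 := (ψ⁻¹).constantCoeff_eq_zero
  have h := mem_sphericalPhylonGroup.1 (inv_mem hψ)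
  have h1 := lamLinear_det_mul_subst hd h0 h i b
  have h2 := sq_eq_one_iff.1 (constantCoeff_det_jacobian_sq h0 h)
  rw [act, mul_comm]
  change lamLinear d i (modulus (jacobian (ψ⁻¹).toFun).det * _) = _
  rw [modulus]
  -- The sign chosen by the modulus cancels the factor det J(0) = ±1.
  rcases h2 with h2 | h2
  · rw [if_pos (by rw [h2]; norm_num), h1, h2, one_mul]
  · rw [if_neg (by rw [h2]; norm_num), neg_mul, map_neg, h1, h2, neg_one_mul, neg_neg]

/-! ### Spherical maps from the Cayley transform -/

lemma matrix_mul_mem_ordIdeal {k l : ℕ} {M N : Matrix (Fin d) (Fin d) (Series d)}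
    (hM : ∀ i j, M i j ∈ ordIdeal d k) (hN : ∀ i j, N i j ∈ ordIdeal d l) (i j : Fin d) :
    (M * N) i j ∈ ordIdeal d (k + l) := by
  rw [Matrix.mul_apply]
  exact sum_mem fun m _ => mul_mem_ordIdeal (hM i m) (hN m j)

lemma mulVec_X_mem_ordIdeal {k : ℕ} {M : Matrix (Fin d) (Fin d) (Series d)}
    (hM : ∀ i j, M i j ∈ ordIdeal d k) (i : Fin d) : M.mulVec X i ∈ ordIdeal d (k + 1) := by
  rw [Matrix.mulVec, dotProduct]
  exact sum_mem fun m _ => mul_mem_ordIdeal (hM i m) (X_mem_ordIdeal_one m)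

lemma divergence_mem_ordIdeal {k : ℕ} {Y : Fin d → Series d}
    (hY : ∀ i, Y i ∈ ordIdeal d (k + 1)) : divergence Y ∈ ordIdeal d k :=
  sum_mem fun i _ => pderiv_mem_ordIdeal (hY i) i

lemma isUnit_det_one_sub {A : Matrix (Fin d) (Fin d) (Series d)}
    (hA : ∀ i j, A i j ∈ ordIdeal d 1) : IsUnit (1 - A).det := by
  refine isUnit_iff_constantCoeff.2 ?_
  have h : constantCoeff.mapMatrix A = 0 := by
    ext i j
    exact mem_ordIdeal_one.1 (hA i j)
  rw [RingHom.map_det, map_sub, map_one, h, sub_zero, Matrix.det_one]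
  exact isUnit_one

/-- The Cayley transform of a matrix of formal power series. -/
noncomputable def cayley (A : Matrix (Fin d) (Fin d) (Series d)) :
    Matrix (Fin d) (Fin d) (Series d) := (1 - A)⁻¹ * (1 + A)

/-- For skew `A` transposition swaps 1 - A and 1 + A, and these commute. -/
lemma cayley_transpose_mul_cayley {A : Matrix (Fin d) (Fin d) (Series d)}
    (hA : ∀ i j, A i j ∈ ordIdeal d 1) (hskew : A.transpose = -A) :
    (cayley A).transpose * cayley A = 1 := by
  have h1 := isUnit_det_one_sub hA
  have h2 : IsUnit (1 + A).det := by
    rw [← sub_neg_eq_add]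
    exact isUnit_det_one_sub fun i j => neg_mem (hA i j)
  have ht : (1 - A).transpose = 1 + A := by
    rw [Matrix.transpose_sub, Matrix.transpose_one, hskew, sub_neg_eq_add]
  have ht' : (1 + A).transpose = 1 - A := by
    rw [Matrix.transpose_add, Matrix.transpose_one, hskew, sub_eq_add_neg]
  have hc : (1 + A) * (1 - A) = (1 - A) * (1 + A) := by noncomm_ring
  have hcomm : (1 + A)⁻¹ * (1 - A)⁻¹ = (1 - A)⁻¹ * (1 + A)⁻¹ := by
    rw [← Matrix.mul_inv_rev, ← Matrix.mul_inv_rev, hc]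
  rw [cayley, Matrix.transpose_mul, Matrix.transpose_nonsing_inv, ht, ht', mul_assoc,
    ← mul_assoc (1 + A)⁻¹, hcomm, mul_assoc, Matrix.nonsing_inv_mul _ h2, mul_one,
    Matrix.mul_nonsing_inv _ h1]

lemma inv_one_sub_sub_one {A : Matrix (Fin d) (Fin d) (Series d)}
    (hA : ∀ i j, A i j ∈ ordIdeal d 1) (i j : Fin d) : ((1 - A)⁻¹ - 1) i j ∈ ordIdeal d 1 := by
  have h : (1 - A)⁻¹ - 1 = (1 - A)⁻¹ * A := by
    have := Matrix.nonsing_inv_mul _ (isUnit_det_one_sub hA)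
    rw [mul_sub, mul_one, sub_eq_iff_eq_add] at this
    nth_rewrite 1 [this]
    abel
  rw [h, ← zero_add 1]
  exact matrix_mul_mem_ordIdeal (fun _ _ => mem_ordIdeal_zero _) hA i j

lemma cayley_eq {A : Matrix (Fin d) (Fin d) (Series d)} (hA : ∀ i j, A i j ∈ ordIdeal d 1) :
    cayley A = (2 : ℝ) • (1 - A)⁻¹ - 1 := by
  have h : 1 + A = (2 : ℝ) • 1 - (1 - A) := by rw [two_smul]; abel
  rw [cayley, h, mul_sub, Matrix.nonsing_inv_mul _ (isUnit_det_one_sub hA), mul_smul_comm, mul_one]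

/-- The Cayley transform is 2(1 - A)⁻¹ - 1. In the resolvent identity both inverses are 1 modulo
order one, which leaves 2(A' - A). -/
lemma cayley_sub_cayley_mem {k : ℕ} {A A' : Matrix (Fin d) (Fin d) (Series d)}
    (hA : ∀ i j, A i j ∈ ordIdeal d 1) (hA' : ∀ i j, A' i j ∈ ordIdeal d 1)
    (h : ∀ i j, (A' - A) i j ∈ ordIdeal d k) (i j : Fin d) :
    (cayley A' - cayley A - (2 : ℝ) • (A' - A)) i j ∈ ordIdeal d (k + 1) := by
  have hU := Matrix.mul_nonsing_inv _ (isUnit_det_one_sub hA)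
  have hU' := Matrix.nonsing_inv_mul _ (isUnit_det_one_sub hA')
  set U := (1 - A)⁻¹ with hUdef
  set U' := (1 - A')⁻¹ with hUdef'
  have e1 : U' - U = U' * (A' - A) * U := by
    have : A' - A = (1 - A) - (1 - A') := by abel
    rw [this, mul_sub, hU', sub_mul, mul_assoc, hU, mul_one, one_mul]
  have e2 : cayley A' - cayley A - (2 : ℝ) • (A' - A) =
      (2 : ℝ) • ((U' - 1) * ((A' - A) * U) + (A' - A) * (U - 1)) := by
    rw [cayley_eq hA, cayley_eq hA', ← hUdef, ← hUdef', sub_sub_sub_cancel_right, ← smul_sub, e1,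
      ← smul_sub]
    congr 1
    noncomm_ring
  rw [e2]
  refine smul_mem_ordIdeal _ (add_mem ?_ ?_)
  · rw [add_comm]
    refine matrix_mul_mem_ordIdeal (inv_one_sub_sub_one hA') ?_ i j
    exact matrix_mul_mem_ordIdeal (k := k) (l := 0) h fun _ _ => mem_ordIdeal_zero _
  · exact matrix_mul_mem_ordIdeal h (inv_one_sub_sub_one hA) i j

/-- The formal map `x ↦ O(x) x`, where `O` is the Cayley transform of `A`. -/
noncomputable def cayleyMap (A : Matrix (Fin d) (Fin d) (Series d)) : Fin d → Series d :=
  (cayley A).mulVec X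

lemma constantCoeff_cayleyMap (A : Matrix (Fin d) (Fin d) (Series d)) (i : Fin d) :
    constantCoeff (cayleyMap A i) = 0 :=
  mem_ordIdeal_one.1 (mulVec_X_mem_ordIdeal (k := 0) (fun _ _ => mem_ordIdeal_zero _) i)

lemma sum_cayleyMap_sq {A : Matrix (Fin d) (Fin d) (Series d)}
    (hA : ∀ i j, A i j ∈ ordIdeal d 1) (hskew : A.transpose = -A) :
    ∑ i, cayleyMap A i ^ 2 = normSq d := by
  have h : (cayley A).mulVec X ⬝ᵥ (cayley A).mulVec X = (X : Fin d → Series d) ⬝ᵥ X := by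
    rw [Matrix.dotProduct_mulVec, ← Matrix.mulVec_transpose, Matrix.mulVec_mulVec,
      cayley_transpose_mul_cayley hA hskew, Matrix.one_mulVec]
  simp only [dotProduct, ← sq] at h
  exact h

lemma cayleyMap_sub_X_mem {A : Matrix (Fin d) (Fin d) (Series d)}
    (hA : ∀ i j, A i j ∈ ordIdeal d 1) (i : Fin d) : cayleyMap A i - X i ∈ ordIdeal d 2 := by
  have h : cayley A - 1 = (2 : ℝ) • ((1 - A)⁻¹ - 1) := by
    rw [cayley_eq hA, smul_sub, two_smul ℝ (1 : Matrix (Fin d) (Fin d) (Series d))]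
    abel
  have h1 : cayleyMap A i - X i = (cayley A - 1).mulVec X i := by
    rw [Matrix.sub_mulVec, Matrix.one_mulVec]
    rfl
  rw [h1]
  refine mulVec_X_mem_ordIdeal (k := 1) (fun i j => ?_) i
  rw [h]
  exact smul_mem_ordIdeal _ (inv_one_sub_sub_one hA i j)

lemma mapMatrix_jacobian_cayleyMap {A : Matrix (Fin d) (Fin d) (Series d)}
    (hA : ∀ i j, A i j ∈ ordIdeal d 1) : constantCoeff.mapMatrix (jacobian (cayleyMap A)) = 1 := by
  ext i j
  have h := mem_ordIdeal_one.1 (pderiv_mem_ordIdeal (cayleyMap_sub_X_mem hA i) j)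
  rw [map_sub, map_sub, sub_eq_zero] at h
  rw [RingHom.mapMatrix_apply, Matrix.map_apply, jacobian_apply, h, pderiv_X_eq_ite,
    Matrix.one_apply]
  simp only [eq_comm (a := j)]
  split_ifs <;> simp

lemma constantCoeff_det_jacobian_cayleyMap {A : Matrix (Fin d) (Fin d) (Series d)}
    (hA : ∀ i j, A i j ∈ ordIdeal d 1) : constantCoeff (jacobian (cayleyMap A)).det = 1 := by
  rw [RingHom.map_det, mapMatrix_jacobian_cayleyMap hA, Matrix.det_one]

/-- The pull-back of the density `b` along `x ↦ O(x) x`. -/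
noncomputable def cayleyPullback (b : Series d) (A : Matrix (Fin d) (Fin d) (Series d)) :
    Series d := (jacobian (cayleyMap A)).det * b.subst (cayleyMap A)

lemma cayleyMap_sub_cayleyMap_mem {k : ℕ} {A A' : Matrix (Fin d) (Fin d) (Series d)}
    (hA : ∀ i j, A i j ∈ ordIdeal d 1) (hA' : ∀ i j, A' i j ∈ ordIdeal d 1)
    (h : ∀ i j, (A' - A) i j ∈ ordIdeal d k) (i : Fin d) :
    cayleyMap A' i - cayleyMap A i - (2 : ℝ) • (A' - A).mulVec X i ∈ ordIdeal d (k + 2) := by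
  have := mulVec_X_mem_ordIdeal (cayley_sub_cayley_mem hA hA' h) i
  rwa [Matrix.sub_mulVec, Matrix.sub_mulVec, Matrix.smul_mulVec] at this

/-- First variation of the pull-back of a density. -/
lemma cayleyPullback_sub_mem (b : Series d) {k : ℕ} (hk : 1 ≤ k)
    {A A' : Matrix (Fin d) (Fin d) (Series d)}
    (hA : ∀ i j, A i j ∈ ordIdeal d 1) (hA' : ∀ i j, A' i j ∈ ordIdeal d 1)
    (h : ∀ i j, (A' - A) i j ∈ ordIdeal d k) :
    cayleyPullback b A' - cayleyPullback b A -
      (2 * constantCoeff b) • divergence ((A' - A).mulVec X) ∈ ordIdeal d (k + 1) := by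
  have hφ := cayleyMap_sub_cayleyMap_mem hA hA' h
  have hφ' : ∀ i, cayleyMap A' i - cayleyMap A i ∈ ordIdeal d (k + 1) := fun i => by
    have h1 := ordIdeal_anti (Nat.le_succ (k + 1)) (hφ i)
    have h2 := smul_mem_ordIdeal (2 : ℝ) (mulVec_X_mem_ordIdeal h i)
    simpa using add_mem h1 h2
  set J := (jacobian (cayleyMap A)).det with hJ
  set J' := (jacobian (cayleyMap A')).det with hJ'
  set D := divergence ((A' - A).mulVec X)
  have hD : D ∈ ordIdeal d k := divergence_mem_ordIdeal (mulVec_X_mem_ordIdeal h)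
  have hN : ∀ i j, (jacobian (cayleyMap A') - jacobian (cayleyMap A)) i j ∈ ordIdeal d k :=
    fun i j => by
      rw [Matrix.sub_apply, jacobian_apply, jacobian_apply, ← map_sub]
      exact pderiv_mem_ordIdeal (hφ' i) j
  have hdet := det_add_sub_det_mem hk _ _ (mapMatrix_jacobian_cayleyMap hA) hN
  rw [add_sub_cancel, ← hJ, ← hJ'] at hdet
  have htr : (jacobian (cayleyMap A') - jacobian (cayleyMap A)).trace - (2 : ℝ) • D ∈
      ordIdeal d (k + 1) := by
    have e : (jacobian (cayleyMap A') - jacobian (cayleyMap A)).trace - (2 : ℝ) • D =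
        divergence fun i => cayleyMap A' i - cayleyMap A i - (2 : ℝ) • (A' - A).mulVec X i := by
      simp only [divergence, map_sub, sum_sub_distrib, Derivation.map_smul, ← smul_sum,
        Matrix.trace, Matrix.diag_apply, Matrix.sub_apply, jacobian_apply, D]
    rw [e]
    exact divergence_mem_ordIdeal hφ
  have hdiff : J' - J - (2 : ℝ) • D ∈ ordIdeal d (k + 1) := by
    simpa using add_mem hdet htr
  have hdiff' : J' - J ∈ ordIdeal d k := by
    simpa using add_mem (ordIdeal_anti (Nat.le_succ k) hdiff) (smul_mem_ordIdeal (2 : ℝ) hD)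
  have hb := subst_sub_subst_mem (constantCoeff_cayleyMap A') (constantCoeff_cayleyMap A) hφ' b
  have hb0 : b.subst (cayleyMap A) - C (constantCoeff b) ∈ ordIdeal d 1 := by
    rw [mem_ordIdeal_one, map_sub, constantCoeff_subst_eq (constantCoeff_cayleyMap A)]
    simp
  -- Product rule for differences: moving the argument of `b` costs order `k + 1`, so only the
  -- Jacobian contributes in degree `k`.
  have e : cayleyPullback b A' - cayleyPullback b A - (2 * constantCoeff b) • D =
      J' * (b.subst (cayleyMap A') - b.subst (cayleyMap A)) +
      (J' - J) * (b.subst (cayleyMap A) - C (constantCoeff b)) +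
      C (constantCoeff b) * (J' - J - (2 : ℝ) • D) := by
    rw [cayleyPullback, cayleyPullback, smul_eq_C_mul, smul_eq_C_mul, map_mul, ← hJ, ← hJ']
    ring
  rw [e]
  exact add_mem (add_mem (Ideal.mul_mem_left _ _ hb) (mul_mem_ordIdeal hdiff' hb0))
    (Ideal.mul_mem_left _ _ hdiff)

/-! ### Solving for the Cayley parameter -/

lemma exists_cayleyPullback_step (hd : 1 < d) {b c : Series d} (hb : constantCoeff b ≠ 0)
    (hΛ : ∀ i, lamLinear d i b = lamLinear d i c) (n : ℕ)
    {A : Matrix (Fin d) (Fin d) (Series d)} (hskew : A.transpose = -A)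
    (hA : ∀ i j, A i j ∈ ordIdeal d 1) (hF : cayleyPullback b A - c ∈ ordIdeal d (n + 1)) :
    ∃ A' : Matrix (Fin d) (Fin d) (Series d), A'.transpose = -A' ∧
      (∀ i j, A' i j ∈ ordIdeal d 1) ∧ cayleyPullback b A' - c ∈ ordIdeal d (n + 2) ∧
      ∀ i j, (A' - A) i j ∈ ordIdeal d (n + 1) := by
  have hlam : lamLinear d (n + 1) (homogeneousComponent (n + 1) (cayleyPullback b A - c)) = 0 := by
    rw [lamLinear_homogeneousComponent, map_sub, cayleyPullback,
      lamLinear_det_mul_subst hd (constantCoeff_cayleyMap A) (sum_cayleyMap_sq hA hskew),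
      constantCoeff_det_jacobian_cayleyMap hA, one_mul, hΛ, sub_self]
  obtain ⟨N, hNskew, hN, hrep⟩ := exists_eq_divergence hd (euler_homogeneousComponent _ _) hlam
  -- Chosen so that the first variation 2b(0) div(rNx) is minus the leading part of the error.
  set r : ℝ := -(2 * constantCoeff b)⁻¹
  have hrN : ∀ i j, (r • N) i j ∈ ordIdeal d (n + 1) := fun i j => smul_mem_ordIdeal r (hN i j)
  have hA' : ∀ i j, (A + r • N) i j ∈ ordIdeal d 1 := fun i j =>
    add_mem (hA i j) (ordIdeal_anti (by omega) (hrN i j))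
  have hsub : A + r • N - A = r • N := by abel
  refine ⟨A + r • N, ?_, hA', ?_, fun i j => by rw [hsub]; exact hrN i j⟩
  · rw [Matrix.transpose_add, Matrix.transpose_smul, hskew, hNskew, smul_neg, neg_add]
  · have h1 := cayleyPullback_sub_mem b (Nat.le_add_left 1 n) hA hA' (by rwa [hsub])
    have h2 := sub_homogeneousComponent_mem_ordIdeal hF
    have h3 : (2 * constantCoeff b) • divergence ((r • N).mulVec X) =
        -divergence (N.mulVec X) := by
      have : divergence ((r • N).mulVec X) = r • divergence (N.mulVec X) := by
        simp only [divergence, Matrix.smul_mulVec, Pi.smul_apply, Derivation.map_smul, smul_sum]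
      rw [this, smul_smul, mul_neg, mul_inv_cancel₀ (mul_ne_zero two_ne_zero hb), neg_one_smul]
    rw [hsub, h3, ← hrep] at h1
    have h4 := add_mem h1 h2
    convert h4 using 1
    ring

/-- The coefficient at a multi-index of degree n no longer changes from `u n` on. -/
lemma exists_limit {u : ℕ → Series d} (hu : ∀ n, u (n + 1) - u n ∈ ordIdeal d (n + 1)) :
    ∃ f : Series d, ∀ n, f - u n ∈ ordIdeal d (n + 1) := by
  have hstab : ∀ (m : Fin d →₀ ℕ) (n : ℕ), m.degree ≤ n → coeff m (u n) = coeff m (u m.degree) := by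
    intro m n hmn
    induction n, hmn using Nat.le_induction with
    | base => rfl
    | succ n hn ih =>
      have := mem_ordIdeal.1 (hu n) m (by omega)
      rw [map_sub, sub_eq_zero] at this
      rw [this, ih]
  let f : Series d := fun m => coeff m (u m.degree)
  have hf : ∀ m, coeff m f = coeff m (u m.degree) := fun m => rfl
  refine ⟨f, fun n => mem_ordIdeal.2 fun m hm => ?_⟩
  rw [map_sub, hf, hstab m n (by omega), sub_self]

lemma exists_cayleyPullback_eq (hd : 1 < d) {b c : Series d} (hb : constantCoeff b ≠ 0)
    (hΛ : ∀ i, lamLinear d i b = lamLinear d i c) :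
    ∃ A : Matrix (Fin d) (Fin d) (Series d), A.transpose = -A ∧
      (∀ i j, A i j ∈ ordIdeal d 1) ∧ cayleyPullback b A = c := by
  let P : ℕ → Matrix (Fin d) (Fin d) (Series d) → Prop := fun n A => A.transpose = -A ∧
    (∀ i j, A i j ∈ ordIdeal d 1) ∧ cayleyPullback b A - c ∈ ordIdeal d (n + 1)
  -- The iteration starts at `A = 0`: the constant terms of `b` and `c` agree because Λ_0 is π^(d/2)
  -- times the constant term.
  have h0 : P 0 0 := by
    refine ⟨by simp, fun i j => zero_mem _, ?_⟩
    have hpi : Real.pi ^ ((d : ℝ) / 2) ≠ 0 := by positivity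
    have hbc := hΛ 0
    rw [lamLinear_zero, lamLinear_zero, mul_right_inj' hpi] at hbc
    rw [zero_add, mem_ordIdeal_one, map_sub, cayleyPullback, map_mul,
      constantCoeff_det_jacobian_cayleyMap (A := 0) (fun i j => zero_mem _),
      constantCoeff_subst_eq (constantCoeff_cayleyMap _), one_mul, hbc, sub_self]
  choose! g hg using fun n (A : Matrix (Fin d) (Fin d) (Series d)) (h : P n A) =>
    exists_cayleyPullback_step hd hb hΛ n h.1 h.2.1 h.2.2
  let u : ℕ → Matrix (Fin d) (Fin d) (Series d) := fun n => Nat.rec 0 (fun n A => g n A) n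
  have hu : ∀ n, P n (u n) := by
    intro n
    induction n with
    | zero => exact h0
    | succ n ih => exact ⟨(hg n _ ih).1, (hg n _ ih).2.1, (hg n _ ih).2.2.1⟩
  choose A hA using fun i j => exists_limit (u := fun n => u n i j)
    fun n => (hg n _ (hu n)).2.2.2 i j
  have hA1 : ∀ i j, (Matrix.of A) i j ∈ ordIdeal d 1 := fun i j => by
    simpa using add_mem (hA i j 0) ((hu 0).2.1 i j)
  refine ⟨Matrix.of A, ?_, hA1, ?_⟩
  · ext1 i j
    refine eq_of_forall_sub_mem_ordIdeal fun k => ordIdeal_anti (Nat.le_succ k) ?_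
    have h1 := congrFun (congrFun (hu k).1 i) j
    have h2 := add_mem (hA j i k) (hA i j k)
    rw [Matrix.transpose_apply, Matrix.neg_apply] at h1
    rw [h1] at h2
    simpa using h2
  -- Continuity of the pull-back: passing from `u k` to the limit changes it only in order `k + 1`,
  -- which is also the order of the remaining error.
  · refine eq_of_forall_sub_mem_ordIdeal fun k => ordIdeal_anti (Nat.le_succ k) ?_
    have h1 := cayleyPullback_sub_mem b (Nat.le_add_left 1 k) (hu k).2.1 hA1
      fun i j => hA i j k
    have h2 := smul_mem_ordIdeal (2 * constantCoeff b) (divergence_mem_ordIdeal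
      (mulVec_X_mem_ordIdeal (M := Matrix.of A - u k) fun i j => hA i j k))
    have h3 := add_mem (add_mem (ordIdeal_anti (Nat.le_succ _) h1) h2) (hu k).2.2
    simpa using h3

/-- Densities with equal Laplace coefficients are related by a spherical phylon. -/
lemma exists_act_eq (hd : 1 < d) {b c : Series d} (hb : constantCoeff b ≠ 0)
    (hΛ : ∀ i, lamLinear d i b = lamLinear d i c) :
    ∃ ψ ∈ sphericalPhylonGroup d, act ψ b = c := by
  obtain ⟨A, hskew, hA, hF⟩ := exists_cayleyPullback_eq hd hb hΛ
  let χ : Phylon d :=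
    { toFun := cayleyMap A
      constantCoeff_eq_zero := constantCoeff_cayleyMap A
      isUnit_linearPart := by
        rw [linearPart_eq, mapMatrix_jacobian_cayleyMap hA, Matrix.det_one]
        exact isUnit_one }
  -- The action pulls back along the inverse, so acting by `χ⁻¹` pulls back along `χ`.
  refine ⟨χ⁻¹, inv_mem (mem_sphericalPhylonGroup.2 (sum_cayleyMap_sq hA hskew)), ?_⟩
  have hmod : modulus (jacobianDet χ) = (jacobian (cayleyMap A)).det := by
    change modulus (jacobian (cayleyMap A)).det = _
    rw [modulus, if_pos (by rw [constantCoeff_det_jacobian_cayleyMap hA]; norm_num)]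
  rw [act, inv_inv, hmod, mul_comm]
  exact hF

end FormalLaplace

theorem theorem2 (d : ℕ) (hd : 1 < d) (b c : FormalLaplace.Series d)
    (hb : MvPowerSeries.constantCoeff b ≠ 0) (hc : MvPowerSeries.constantCoeff c ≠ 0) :
    ((∃ ψ ∈ FormalLaplace.sphericalPhylonGroup d, FormalLaplace.act ψ b = c) ↔
      ∀ i : ℕ, FormalLaplace.Lam i b = FormalLaplace.Lam i c) ∧
    (∀ i : ℕ, FormalLaplace.Lam i b =
      Real.pi ^ ((d : ℝ) / 2) / (((i / 2).factorial : ℝ) * 2 ^ i) *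
        FormalLaplace.completeTrace i b) := by
  refine ⟨?_, fun i => FormalLaplace.Lam_eq_completeTrace i b⟩
  simp only [FormalLaplace.Lam_eq_lamLinear]
  refine ⟨?_, FormalLaplace.exists_act_eq hd hb⟩
  rintro ⟨ψ, hψ, rfl⟩ i
  exact (FormalLaplace.lamLinear_act hd hψ b i).symm
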